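/- Let $k$ be a field of positive characteristic $p$, let $d_1,\dots,d_m$ be positive integers, and let $\mathcal I_0=\{(i,\mathbf r): 1\le i\le m,\ \mathbf r\in\mathbb N^m,\ |\mathbf r|=d_i\}$, where $|\mathbf r|=r_1+\dots+r_m$. Let $K=k(a_{i,\mathbf r}:(i,\mathbf r)\in\mathcal I_0)$ be the field of rational functions in independent variables $a_{i,\mathbf r}$. In $K[x_1,\dots,x_m]$ put $g_i=\sum_{|\mathbf r|=d_i}a_{i,\mathbf r}\,x^{\mathbf r}$, let $\mathcal A=K[x_1,\dots,x_m]/(g_1,\dots,g_m)$ be the generic $(d_1,\dots,d_m)$-complete intersection, $\pi:K[x_1,\dots,x_m]\to\mathcal A$ the projection, and $s=d_1+\dots+d_m-m$. There is a unique $K$-linear isomorphism $\mathrm{vol}:\mathcal A_s\to K$ (the residue map) such that, for every $m\times m$ matrix $N$ over $K[x_1,\dots,x_m]$ with $(g_1,\dots,g_m)^T=N(x_1,\dots,x_m)^T$, one has $\pi(\det N)\in\mathcal A_s$ and $\mathrm{vol}(\pi(\det N))=1$. For a finite multisubset $\mathcal I=\{\!\{(i_1,\mathbf r_1),\dots,(i_n,\mathbf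 r_n)\}\!\}$ of $\mathcal I_0$ let $\partial^{\mathcal I}=\frac{\partial}{\partial a_{i_1,\mathbf r_1}}\circ\dots\circ\frac{\partial}{\partial a_{i_n,\mathbf r_n}}:K\to K$ and $x^{\mathcal I}=x^{\mathbf r_1}\cdots x^{\mathbf r_n}$. For a monic Laurent monomial $u$ let $u^{1/p}$ be the monic Laurent monomial whose $p$-th power is $u$ if it exists, and $0$ otherwise. Let $\varphi:K[x_1^{\pm1},\dots,x_m^{\pm1}]\to K[x_1,\dots,x_m]$ be the $K$-linear map with $\varphi(x^{\mathbf r})=x^{\mathbf r}$ if $\mathbf r\in\mathbb N^m$ and $\varphi(x^{\mathbf r})=0$ for all other $\mathbf r\in\mathbb Z^m$. Then for every $\mathbf s\in\mathbb N^m$ with $|\mathbf s|=s$ and every multisubset $\mathcal I$ of $\mathcal I_0$ that contains, for each $i=1,\dots,m$, exactly $p-1$ elements (counted with multiplicity) of the form $(i,\mathbf r)$, $$\partial^{\mathcal I}\bigl((\mathrm{vol}\circ\pi)(x^{\mathbf s})\bigr)=(-1)^m\Bigl((\mathrm{vol}\circ\pi\circ\varphi)\bigl((x^{\mathbf s}\,x^{\mathcal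 I}\,x^{(1-p)\mathbf 1})^{1/p}\bigr)\Bigr)^p,\qquad \mathbf 1=(1,\dots,1).$$ -/

import Mathlib

open scoped BigOperators

noncomputable section

namespace GenericCI

/-! ### Graded pieces of a quotient and the residue map -/

section Residue

variable {F : Type*} [Field F] {m : ℕ}

/-- The ideal `(g₁, …, g_m)` of `F[x₁, …, x_m]`. -/
def idealOf (g : Fin m → MvPolynomial (Fin m) F) : Ideal (MvPolynomial (Fin m) F) :=
  Ideal.span (Set.range g)

/-- The quotient ring `A = F[x₁, …, x_m] / (g₁, …, g_m)`. -/
abbrev QuotRing (g : Fin m → MvPolynomial (Fin m) F) : Type _ :=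
  MvPolynomial (Fin m) F ⧸ idealOf g

/-- The natural projection `π : F[x₁, …, x_m] → A`. -/
def proj (g : Fin m → MvPolynomial (Fin m) F) : MvPolynomial (Fin m) F →ₐ[F] QuotRing g :=
  Ideal.Quotient.mkₐ F (idealOf g)

/-- The graded piece `A_n`, i.e. the image under `π` of the forms of degree `n`. -/
def gradedPiece (g : Fin m → MvPolynomial (Fin m) F) (n : ℕ) : Submodule F (QuotRing g) :=
  (MvPolynomial.homogeneousSubmodule (Fin m) F n).map (proj g).toLinearMap

/-- The map `π` in degree `n`, from forms of degree `n` to `A_n`. -/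
def projDeg (g : Fin m → MvPolynomial (Fin m) F) (n : ℕ) :
    MvPolynomial.homogeneousSubmodule (Fin m) F n →ₗ[F] gradedPiece g n :=
  (proj g).toLinearMap.submoduleMap (MvPolynomial.homogeneousSubmodule (Fin m) F n)

/-- `vol : A_n ≃ F` is the residue map: for every matrix `N` over `F[x₁, …, x_m]` with
`g = N x`, the class `π (det N)` lies in `A_n` and is sent to `1`. -/
def IsResidueMap (g : Fin m → MvPolynomial (Fin m) F) (n : ℕ)
    (vol : gradedPiece g n ≃ₗ[F] F) : Prop :=
  ∀ N : Matrix (Fin m) (Fin m) (MvPolynomial (Fin m) F),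
    N.mulVec (fun j => MvPolynomial.X j) = g →
      ∃ h : proj g N.det ∈ gradedPiece g n, vol ⟨proj g N.det, h⟩ = 1

end Residue

/-! ### The generic complete intersection -/

/-- The index set of all pairs `(i, r)` with `r ∈ ℕ^m` and `|r| = d_i`. -/
abbrev Index {m : ℕ} (d : Fin m → ℕ) : Type :=
  (i : Fin m) × {r : Fin m →₀ ℕ // r.degree = d i}

instance exponentFintype (m n : ℕ) : Fintype {r : Fin m →₀ ℕ // r.degree = n} :=
  Fintype.subtype (Finset.univ.finsuppAntidiag n) (fun r => by
    rw [Finset.mem_finsuppAntidiag, Finsupp.degree_eq_sum]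
    simp)

section Generic

variable (k : Type*) [Field k] {m : ℕ} (d : Fin m → ℕ)

/-- The polynomial ring `k[a_{i,r}]` in the auxiliary indeterminates. -/
abbrev AuxPoly : Type _ := MvPolynomial (Index d) k

/-- The field of rational functions `K = k(a_{i,r})`. -/
abbrev AuxField : Type _ := FractionRing (AuxPoly k d)

/-- The auxiliary indeterminate `a_{i,r}`, as an element of `K`. -/
def auxVar (ι : Index d) : AuxField k d :=
  algebraMap (AuxPoly k d) (AuxField k d) (MvPolynomial.X ι)

/-- The generic form `g_i = ∑_{|r| = d_i} a_{i,r} x^r`. -/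
def genericForm (i : Fin m) : MvPolynomial (Fin m) (AuxField k d) :=
  ∑ r : {r : Fin m →₀ ℕ // r.degree = d i}, MvPolynomial.monomial r.1 (auxVar k d ⟨i, r⟩)

/-- `s = d₁ + ⋯ + d_m - m`; the subtraction is not truncated when all `d_i` are positive. -/
def topDegree : ℕ := (∑ i, d i) - m

end Generic

/-! ### Partial derivatives on the field of rational functions -/

section Deriv

variable {k : Type*} [Field k] {m : ℕ} {d : Fin m → ℕ}

/-- The quotient rule `(∂u · v - u · ∂v) / v²`, for polynomials `u`, `v`. -/
def quotientRule (ι : Index d) (u v : AuxPoly k d) : AuxField k d :=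
  algebraMap (AuxPoly k d) (AuxField k d)
      (MvPolynomial.pderiv ι u * v - u * MvPolynomial.pderiv ι v) /
    algebraMap (AuxPoly k d) (AuxField k d) v ^ 2

lemma quotientRule_eq (ι : Index d) {u v u' v' : AuxPoly k d} (hv : v ≠ 0) (hv' : v' ≠ 0)
    (h : u * v' = u' * v) : quotientRule ι u v = quotientRule ι u' v' := by
  have hd := congrArg (MvPolynomial.pderiv ι) h
  simp only [MvPolynomial.pderiv_mul] at hd
  have inj : Function.Injective (algebraMap (AuxPoly k d) (AuxField k d)) :=
    IsFractionRing.injective _ _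
  have hV : algebraMap (AuxPoly k d) (AuxField k d) v ≠ 0 := by
    simpa using inj.ne hv
  have hV' : algebraMap (AuxPoly k d) (AuxField k d) v' ≠ 0 := by
    simpa using inj.ne hv'
  unfold quotientRule
  rw [div_eq_div_iff (pow_ne_zero 2 hV) (pow_ne_zero 2 hV')]
  simp only [← map_pow, ← map_mul]
  congr 1
  linear_combination (v * v') * hd - (MvPolynomial.pderiv ι v' * v +
    MvPolynomial.pderiv ι v * v') * h

/-- The underlying function of `∂/∂a_{i,r}` on `K`: the quotient rule applied to some
representation of a rational function as a fraction. -/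
def partialFun (ι : Index d) (f : AuxField k d) : AuxField k d :=
  quotientRule ι (IsLocalization.sec (nonZeroDivisors (AuxPoly k d)) f).1
    (IsLocalization.sec (nonZeroDivisors (AuxPoly k d)) f).2

lemma partialFun_div (ι : Index d) (u v : AuxPoly k d) (hv : v ≠ 0) :
    partialFun ι (algebraMap (AuxPoly k d) (AuxField k d) u /
      algebraMap (AuxPoly k d) (AuxField k d) v) = quotientRule ι u v := by
  have inj : Function.Injective (algebraMap (AuxPoly k d) (AuxField k d)) :=
    IsFractionRing.injective _ _
  have hV : algebraMap (AuxPoly k d) (AuxField k d) v ≠ 0 := by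
    simpa using inj.ne hv
  have hs := IsLocalization.sec_spec (nonZeroDivisors (AuxPoly k d))
    (algebraMap (AuxPoly k d) (AuxField k d) u / algebraMap (AuxPoly k d) (AuxField k d) v)
  refine quotientRule_eq ι (nonZeroDivisors.ne_zero (Subtype.coe_prop _)) hv (inj ?_)
  rw [map_mul, map_mul, ← hs]
  field_simp

lemma exists_div (f : AuxField k d) : ∃ u v : AuxPoly k d, v ≠ 0 ∧
    f = algebraMap (AuxPoly k d) (AuxField k d) u /
      algebraMap (AuxPoly k d) (AuxField k d) v := by
  obtain ⟨u, v, hv, rfl⟩ := IsFractionRing.div_surjective (A := AuxPoly k d) f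
  exact ⟨u, v, nonZeroDivisors.ne_zero hv, rfl⟩

lemma partialFun_algebraMap (ι : Index d) (u : AuxPoly k d) :
    partialFun ι (algebraMap (AuxPoly k d) (AuxField k d) u) =
      algebraMap (AuxPoly k d) (AuxField k d) (MvPolynomial.pderiv ι u) := by
  have h := partialFun_div ι u 1 one_ne_zero
  simpa [quotientRule] using h

lemma partialFun_add (ι : Index d) (f g : AuxField k d) :
    partialFun ι (f + g) = partialFun ι f + partialFun ι g := by
  obtain ⟨u, v, hv, rfl⟩ := exists_div f
  obtain ⟨u', v', hv', rfl⟩ := exists_div g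
  have inj : Function.Injective (algebraMap (AuxPoly k d) (AuxField k d)) :=
    IsFractionRing.injective _ _
  have hV : algebraMap (AuxPoly k d) (AuxField k d) v ≠ 0 := by simpa using inj.ne hv
  have hV' : algebraMap (AuxPoly k d) (AuxField k d) v' ≠ 0 := by simpa using inj.ne hv'
  rw [div_add_div _ _ hV hV', ← map_mul, ← map_mul, ← map_mul, ← map_add,
    partialFun_div _ _ _ (mul_ne_zero hv hv'), partialFun_div _ _ _ hv,
    partialFun_div _ _ _ hv']
  simp only [quotientRule, MvPolynomial.pderiv_mul, map_add, map_mul, map_sub]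
  field_simp
  ring

lemma partialFun_mul (ι : Index d) (f g : AuxField k d) :
    partialFun ι (f * g) = f * partialFun ι g + g * partialFun ι f := by
  obtain ⟨u, v, hv, rfl⟩ := exists_div f
  obtain ⟨u', v', hv', rfl⟩ := exists_div g
  have inj : Function.Injective (algebraMap (AuxPoly k d) (AuxField k d)) :=
    IsFractionRing.injective _ _
  have hV : algebraMap (AuxPoly k d) (AuxField k d) v ≠ 0 := by simpa using inj.ne hv
  have hV' : algebraMap (AuxPoly k d) (AuxField k d) v' ≠ 0 := by simpa using inj.ne hv'
  rw [div_mul_div_comm, ← map_mul, ← map_mul,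
    partialFun_div _ _ _ (mul_ne_zero hv hv'), partialFun_div _ _ _ hv,
    partialFun_div _ _ _ hv']
  simp only [quotientRule, MvPolynomial.pderiv_mul, map_add, map_mul, map_sub]
  field_simp
  ring

/-- The partial derivative `∂/∂a_{i,r} : K → K`, as a `k`-linear derivation. -/
def partialDeriv (ι : Index d) : Derivation k (AuxField k d) (AuxField k d) :=
  Derivation.mk'
    { toFun := partialFun ι
      map_add' := partialFun_add ι
      map_smul' := fun c f => by
        have hc : algebraMap k (AuxField k d) c =
            algebraMap (AuxPoly k d) (AuxField k d) (MvPolynomial.C c) := by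
          rw [IsScalarTower.algebraMap_apply k (AuxPoly k d) (AuxField k d),
            MvPolynomial.algebraMap_eq]
        simp only [Algebra.smul_def, partialFun_mul, RingHom.id_apply]
        rw [hc, partialFun_algebraMap]
        simp }
    (fun f g => by simpa using partialFun_mul ι f g)

lemma partialDeriv_algebraMap (ι : Index d) (u : AuxPoly k d) :
    partialDeriv ι (algebraMap (AuxPoly k d) (AuxField k d) u) =
      algebraMap (AuxPoly k d) (AuxField k d) (MvPolynomial.pderiv ι u) :=
  partialFun_algebraMap ι u

lemma pderiv_comm (ι κ : Index d) (u : AuxPoly k d) :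
    MvPolynomial.pderiv ι (MvPolynomial.pderiv κ u) =
      MvPolynomial.pderiv κ (MvPolynomial.pderiv ι u) := by
  classical
  have h : ⁅(MvPolynomial.pderiv ι : Derivation k (AuxPoly k d) (AuxPoly k d)),
      (MvPolynomial.pderiv κ : Derivation k (AuxPoly k d) (AuxPoly k d))⁆ = 0 := by
    refine MvPolynomial.derivation_ext fun j => ?_
    simp only [Derivation.commutator_apply, MvPolynomial.pderiv_X, Derivation.zero_apply,
      Pi.single_apply]
    split_ifs <;> simp
  have := congrArg (fun D => D u) h
  simpa [Derivation.commutator_apply, sub_eq_zero] using this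

lemma partialDeriv_comm (ι κ : Index d) (f : AuxField k d) :
    partialDeriv ι (partialDeriv κ f) = partialDeriv κ (partialDeriv ι f) := by
  have h0 : ∀ u : AuxPoly k d,
      ⁅(partialDeriv ι : Derivation k (AuxField k d) (AuxField k d)), partialDeriv κ⁆
        (algebraMap (AuxPoly k d) (AuxField k d) u) = 0 := by
    intro u
    rw [Derivation.commutator_apply]
    simp only [partialDeriv_algebraMap]
    rw [pderiv_comm, sub_self]
  obtain ⟨u, v, hv, rfl⟩ := exists_div f
  have h : ⁅(partialDeriv ι : Derivation k (AuxField k d) (AuxField k d)), partialDeriv κ⁆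
      (algebraMap (AuxPoly k d) (AuxField k d) u /
      algebraMap (AuxPoly k d) (AuxField k d) v) = 0 := by
    rw [Derivation.leibniz_div, h0, h0]
    simp
  rw [Derivation.commutator_apply] at h
  exact sub_eq_zero.mp h

instance partialDeriv_leftCommutative :
    LeftCommutative (fun (ι : Index d) (f : AuxField k d) => partialDeriv ι f) :=
  ⟨fun ι κ f => partialDeriv_comm ι κ f⟩

/-- The composite `∂^I` of all `∂/∂a_{i,r}`, `(i, r) ∈ I` with multiplicity (the order of
composition is irrelevant, the partial derivatives commute). -/
def multiDeriv (I : Multiset (Index d)) (f : AuxField k d) : AuxField k d :=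
  I.foldr (fun ι f => partialDeriv ι f) f

end Deriv

/-! ### Monomials -/

section Monomials

variable {m : ℕ} {d : Fin m → ℕ}

/-- `I` contains, with multiplicity, exactly `p - 1` elements of the form `(i, r)`, for each `i`. -/
def HasProperty (p : ℕ) (I : Multiset (Index d)) : Prop :=
  ∀ i : Fin m, I.countP (fun ι => ι.1 = i) = p - 1

/-- The exponent vector of `x^I`, i.e. the sum of all `r` with `(i, r) ∈ I`. -/
def indexExponent (I : Multiset (Index d)) : Fin m →₀ ℕ :=
  (I.map (fun ι => ι.2.1)).sum

/-- The exponent vector of the monic Laurent monomial `x^t x^I x^{(1-p)𝟏}`. -/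
def laurentExponent (p : ℕ) (t : Fin m →₀ ℕ) (I : Multiset (Index d)) (j : Fin m) : ℤ :=
  (t j : ℤ) + (indexExponent I j : ℤ) + (1 - (p : ℤ))

/-- Laurent polynomials in `x₁, …, x_m` over `F`. -/
abbrev Laurent (F : Type*) [Field F] (m : ℕ) : Type _ := AddMonoidAlgebra F (Fin m → ℤ)

/-- The monic Laurent monomial `x^e`. -/
def laurentMonomial (F : Type*) [Field F] (e : Fin m → ℤ) : Laurent F m :=
  AddMonoidAlgebra.single e 1

open Classical in
/-- `(x^e)^{1/p}`: the monic Laurent monomial whose `p`-th power is `x^e` if there is one,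
and `0` otherwise. -/
def laurentRoot (F : Type*) [Field F] (p : ℕ) (e : Fin m → ℤ) : Laurent F m :=
  if ∀ j, (p : ℤ) ∣ e j then laurentMonomial F (fun j => e j / (p : ℤ)) else 0

open Classical in
/-- The `F`-linear map from Laurent polynomials to polynomials with `x^e ↦ x^e` if all the
exponents are nonnegative, and `x^e ↦ 0` otherwise. -/
def truncate (F : Type*) [Field F] (m : ℕ) : Laurent F m →ₗ[F] MvPolynomial (Fin m) F :=
  (Finsupp.linearCombination F (fun e : Fin m → ℤ =>
      if ∀ j, 0 ≤ e j then
        MvPolynomial.monomial (Finsupp.equivFunOnFinite.symm fun j => (e j).toNat) (1 : F)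
      else 0)) ∘ₗ
    (AddMonoidAlgebra.coeffLinearEquiv F).toLinearMap

lemma truncate_laurentMonomial (F : Type*) [Field F] (e : Fin m → ℤ) (he : ∀ j, 0 ≤ e j) :
    truncate F m (laurentMonomial F e) =
      MvPolynomial.monomial (Finsupp.equivFunOnFinite.symm fun j => (e j).toNat) 1 := by
  simp [truncate, laurentMonomial, he]

lemma truncate_laurentMonomial_of_neg (F : Type*) [Field F] (e : Fin m → ℤ)
    (he : ¬ ∀ j, 0 ≤ e j) : truncate F m (laurentMonomial F e) = 0 := by
  simp only [truncate, laurentMonomial]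
  simp [he]

lemma sum_indexExponent {p : ℕ} {I : Multiset (Index d)} (hI : HasProperty p I) :
    ∑ j, indexExponent I j = (p - 1) * ∑ i, d i := by
  classical
  have h1 : ∀ J : Multiset (Index d), ∑ j, indexExponent J j =
      ∑ i, J.countP (fun ι => ι.1 = i) * d i := by
    intro J
    induction J using Multiset.induction_on with
    | empty => simp [indexExponent]
    | cons ι J ih =>
      have hc : indexExponent (ι ::ₘ J) = ι.2.1 + indexExponent J := by simp [indexExponent]
      have hdeg : ∑ j, ι.2.1 j = d ι.1 := by
        rw [← Finsupp.degree_eq_sum]; exact ι.2.2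
      simp only [hc, Finsupp.add_apply, Finset.sum_add_distrib, ih, hdeg, Multiset.countP_cons,
        add_mul, ite_mul, one_mul, zero_mul]
      simp [add_comm]
  rw [h1, Finset.mul_sum]
  exact Finset.sum_congr rfl fun i _ => by rw [hI i]

/-- `φ ((x^t x^I x^{(1-p)𝟏})^{1/p})` is a form of degree `s`. -/
lemma truncate_laurentRoot_mem (F : Type*) [Field F] {p : ℕ} (hp : 0 < p) (hd : ∀ i, 0 < d i)
    {t : Fin m →₀ ℕ} (ht : t.degree = topDegree d) {I : Multiset (Index d)}
    (hI : HasProperty p I) :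
    truncate F m (laurentRoot F p (laurentExponent p t I)) ∈
      MvPolynomial.homogeneousSubmodule (Fin m) F (topDegree d) := by
  classical
  unfold laurentRoot
  split_ifs with h
  · by_cases h0 : ∀ j, 0 ≤ laurentExponent p t I j / (p : ℤ)
    · rw [truncate_laurentMonomial F _ h0, MvPolynomial.mem_homogeneousSubmodule]
      refine MvPolynomial.isHomogeneous_monomial _ ?_
      have hm : m ≤ ∑ i, d i := by
        calc m = ∑ _i : Fin m, 1 := by simp
          _ ≤ ∑ i, d i := Finset.sum_le_sum fun i _ => hd i
      have hp0 : (p : ℤ) ≠ 0 := by exact_mod_cast hp.ne'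
      have key : (p : ℤ) * ∑ j, laurentExponent p t I j / (p : ℤ) = p * (topDegree d : ℤ) := by
        have e0 : ∀ j, (p : ℤ) * (laurentExponent p t I j / (p : ℤ)) = laurentExponent p t I j :=
          fun j => Int.mul_ediv_cancel' (h j)
        simp only [Finset.mul_sum, e0]
        have e1 : (∑ j, (t j : ℤ)) = (topDegree d : ℤ) := by
          rw [← ht, Finsupp.degree_eq_sum]; push_cast; rfl
        have e2 : (∑ j, (indexExponent I j : ℤ)) = ((p : ℤ) - 1) * ∑ i, (d i : ℤ) := by
          have := congrArg (Nat.cast : ℕ → ℤ) (sum_indexExponent hI)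
          rw [Nat.cast_mul, Nat.cast_sub hp] at this; push_cast at this
          exact this
        have e3 : (topDegree d : ℤ) = ∑ i, (d i : ℤ) - m := by
          rw [topDegree, Nat.cast_sub hm]; push_cast; rfl
        simp only [laurentExponent, Finset.sum_add_distrib, e1, e2, Finset.sum_const,
          Finset.card_univ, Fintype.card_fin, nsmul_eq_mul]
        rw [e3]; ring
      have key' := mul_left_cancel₀ hp0 key
      rw [Finsupp.degree_eq_sum]
      zify
      rw [← key']
      refine Finset.sum_congr rfl fun j _ => ?_
      rw [Finsupp.equivFunOnFinite_symm_apply_apply, Int.toNat_of_nonneg (h0 j)]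
    · rw [truncate_laurentMonomial_of_neg F _ h0]
      exact Submodule.zero_mem _
  · rw [map_zero]
    exact Submodule.zero_mem _

lemma monomial_mem (F : Type*) [Field F] {t : Fin m →₀ ℕ} {n : ℕ} (ht : t.degree = n) :
    MvPolynomial.monomial t (1 : F) ∈ MvPolynomial.homogeneousSubmodule (Fin m) F n :=
  (MvPolynomial.mem_homogeneousSubmodule _ _).2 (MvPolynomial.isHomogeneous_monomial _ ht)

end Monomials

end GenericCI

end

/-!
Let `V = vol ∘ π`, and let `θ` be the `K`-linear functional with
`θ (x^{p u + (p-1)𝟏}) = (V x^u)^p` that kills all other monomials; it plays the role of the residue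
with respect to `g₁^p, …, g_m^p`. The heart of the proof is the identity

  `V f = θ (f g₁^{p-1} ⋯ g_m^{p-1})` for forms `f` of degree `s`

(`volFunctional_eq_frobeniusFunctional`). Since the degree `s` piece of `A` is a line, it suffices
to see that the right-hand side kills the ideal `(g₁, …, g_m)`, because `θ` kills `(g_i^p)`, and that
it equals `1` on `det N` if `g = N x`. For the latter, the matrices `(g_i^{p-1} N_{ij})` and
`(N_{ij}^p x_j^{p-1})` both carry `x` to `g^p`, so
`det N ∏ g_i^{p-1} ≡ (det N)^p ∏ x_j^{p-1}` modulo `(g_i^p)`, and `θ` is `V (det N)^p = 1` on the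
right-hand side.

The values of `θ` on monomials are `p`-th powers, hence constants for every derivation of `K`, so
`∂^I (V x^t) = θ (x^t ∂^I ∏ g_i^{p-1})`, where the derivatives act on coefficients. If `I` contains
`p - 1` indices of each form `g_i`, then `∂^I ∏ g_i^{p-1} = ((p-1)!)^m x^I = (-1)^m x^I` by Wilson's
theorem, and `θ (x^t x^I)` is the `p`-th power in the claim.

Three facts about the generic complete intersection carry this and the existence of `vol`.
* The class of `det N` does not depend on `N` (`det_sub_det_mem`): two choices of a row differ by a
  syzygy of the variables, thus by Koszul relations, along which cofactors are proportional.
* `A_s` is spanned by the class of `∏ x_i^{d_i-1}` (`exists_proj_eq_smul`), because this holds for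
  the specialization `g_i = x_i^{d_i}`, and the rank of a matrix does not increase under
  specialization.
* `det N` is not in the ideal for some `N` (`map_det_notMem`): embed `K` into the fraction field of
  `k[a]⟦ε⟧` so that `g_i` becomes `x_i^{d_i} + ε h_i`. Expanding `∏ 1 / (x_i^{d_i} + ε h_i)` in powers
  of `ε` and taking the coefficient of `x₁⁻¹ ⋯ x_m⁻¹` gives a functional that kills the ideal and is
  `1` modulo `ε` on `det N`.
-/

noncomputable section

namespace GenericCI

/-! ### Determinants of matrices expressing forms through the variables -/

section Determinant

open MvPolynomial

/-- The syzygies of the variables are generated by the Koszul relations: a family that respects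
the Koszul relations pairs to zero with every syzygy. -/
lemma sum_smul_eq_zero_of_syzygy {R σ M : Type*} [CommRing R] [AddCommGroup M]
    [Module (MvPolynomial σ R) M] (v : σ → M)
    (hv : ∀ a b, (X a : MvPolynomial σ R) • v b = (X b : MvPolynomial σ R) • v a)
    (S : Finset σ) (D : σ → MvPolynomial σ R) (hD : ∑ j ∈ S, D j * X j = 0) :
    ∑ j ∈ S, D j • v j = 0 := by
  classical
  induction S using Finset.induction_on generalizing D with
  | empty => simp
  | insert a S ha ih =>
    rw [Finset.sum_insert ha] at hD ⊢
    -- `D a * X a` lies in the monomial ideal of the remaining variables, hence so does `D a`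
    have hmem : D a * X a ∈ Ideal.span ((X : σ → MvPolynomial σ R) '' (S : Set σ)) := by
      rw [eq_neg_of_add_eq_zero_left hD]
      refine neg_mem (sum_mem fun j hj => Ideal.mul_mem_left _ _ ?_)
      exact Ideal.subset_span ⟨j, hj, rfl⟩
    have hDa : D a ∈ Ideal.span ((X : σ → MvPolynomial σ R) '' (S : Set σ)) := by
      rw [mem_ideal_span_X_image] at hmem ⊢
      intro e he
      have he' : e + Finsupp.single a 1 ∈ (D a * X a).support := by
        rw [mem_support_iff, coeff_mul_X]
        exact mem_support_iff.1 he
      obtain ⟨i, hi, hne⟩ := hmem _ he'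
      refine ⟨i, hi, ?_⟩
      have : a ≠ i := fun h => ha (by rw [h]; exact hi)
      simpa [Finsupp.single_apply, this] using hne
    obtain ⟨q, hq⟩ : ∃ q : σ → MvPolynomial σ R, ∑ j ∈ S, q j • (X j : MvPolynomial σ R) = D a := by
      obtain ⟨q, hq⟩ := (Submodule.mem_span_image_finset_iff_exists_fun _).1 hDa
      refine ⟨fun j => if h : j ∈ S then q ⟨j, h⟩ else 0, ?_⟩
      rw [← hq, ← Finset.sum_coe_sort]
      exact Finset.sum_congr rfl fun j _ => by simp
    have key := ih (fun j => q j * X a + D j) (by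
      rw [← hD, ← hq, Finset.sum_mul, ← Finset.sum_add_distrib]
      refine Finset.sum_congr rfl fun j _ => ?_
      simp only [smul_eq_mul]
      ring)
    rw [← key, ← hq, Finset.sum_smul, ← Finset.sum_add_distrib]
    refine Finset.sum_congr rfl fun j _ => ?_
    rw [add_smul, smul_assoc, mul_smul, hv j a]

/-- Modulo an ideal containing `(M x)_j` for `j ≠ i`, the cofactors along the row `i` are
proportional to `x`. -/
lemma mul_adjugate_sub_mem {R n : Type*} [CommRing R] [Fintype n] [DecidableEq n] (I : Ideal R)
    (M : Matrix n n R) (i : n) (x : n → R) (h : ∀ j, j ≠ i → M.mulVec x j ∈ I) (a b : n) :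
    x a * M.adjugate b i - x b * M.adjugate a i ∈ I := by
  set M' := M.updateRow i (Pi.single a 1) with hM'
  have hb : M'.adjugate b i = M.adjugate b i := by
    rw [Matrix.adjugate_apply, Matrix.adjugate_apply, hM', Matrix.updateRow_idem]
  have ha : M'.det = M.adjugate a i := by rw [Matrix.adjugate_apply]
  have hi : M'.mulVec x i = x a := by simp [hM', Matrix.mulVec]
  have hj : ∀ j, j ≠ i → M'.mulVec x j ∈ I := by
    intro j hji
    have : M'.mulVec x j = M.mulVec x j := by
      simp [hM', Matrix.mulVec, Matrix.updateRow_ne hji]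
    rw [this]
    exact h j hji
  have key : (M'.adjugate.mulVec (M'.mulVec x)) b = M'.det * x b := by
    rw [Matrix.mulVec_mulVec, Matrix.adjugate_mul, Matrix.smul_mulVec, Matrix.one_mulVec]
    simp
  rw [Matrix.mulVec, dotProduct, ← Finset.add_sum_erase _ _ (Finset.mem_univ i), hi, hb, ha] at key
  have : x a * M.adjugate b i - x b * M.adjugate a i =
      -∑ j ∈ Finset.univ.erase i, M'.adjugate b j * M'.mulVec x j := by
    linear_combination key
  rw [this]
  exact neg_mem (sum_mem fun j hjm => Ideal.mul_mem_left _ _ (hj j (Finset.ne_of_mem_erase hjm)))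

/-- Modulo `(g₁, …, g_m)`, the determinant of a matrix `N` with `g = N x` does not depend on
`N`: exchange one row at a time. -/
lemma det_sub_det_mem {R σ : Type*} [CommRing R] [Fintype σ] [DecidableEq σ]
    (g : σ → MvPolynomial σ R) (N N' : Matrix σ σ (MvPolynomial σ R))
    (hN : N.mulVec (fun j => X j) = g) (hN' : N'.mulVec (fun j => X j) = g) :
    N'.det - N.det ∈ Ideal.span (Set.range g) := by
  set I := Ideal.span (Set.range g) with hI
  have hg : ∀ i, g i ∈ I := fun i => Ideal.subset_span ⟨i, rfl⟩
  have main : ∀ S : Finset σ,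
      (Matrix.of fun i j => if i ∈ S then N' i j else N i j).det - N.det ∈ I := by
    intro S
    induction S using Finset.induction_on with
    | empty =>
      have : (Matrix.of fun i j => if i ∈ (∅ : Finset σ) then N' i j else N i j) = N := by
        ext i j; simp
      rw [this, sub_self]; exact I.zero_mem
    | insert i S hiS ih =>
      set M : Matrix σ σ (MvPolynomial σ R) :=
        Matrix.of fun i j => if i ∈ S then N' i j else N i j with hM
      have hins : (Matrix.of fun a j => if a ∈ insert i S then N' a j else N a j) =
          M.updateRow i (fun j => N' i j) := by
        ext a j
        rcases eq_or_ne a i with rfl | ha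
        · simp
        · simp [hM, ha, Matrix.updateRow_ne]
      have hMi : ∀ j, M i j = N i j := by
        intro j; simp [hM, hiS]
      have hMx : ∀ j, M.mulVec (fun j => X j) j ∈ I := by
        intro j
        have h1 := congrFun hN j
        have h2 := congrFun hN' j
        have : M.mulVec (fun j => X j) j = g j := by
          by_cases hj : j ∈ S
          · rw [← h2]; simp [Matrix.mulVec, dotProduct, hM, hj]
          · rw [← h1]; simp [Matrix.mulVec, dotProduct, hM, hj]
        rw [this]; exact hg j
      have hdet : (M.updateRow i (fun j => N' i j)).det = ∑ j, N' i j * M.adjugate j i := by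
        rw [Matrix.det_eq_sum_mul_adjugate_row _ i]
        refine Finset.sum_congr rfl fun j _ => ?_
        rw [Matrix.updateRow_self, Matrix.adjugate_apply, Matrix.adjugate_apply,
          Matrix.updateRow_idem]
      have hdet' : M.det = ∑ j, N i j * M.adjugate j i := by
        rw [Matrix.det_eq_sum_mul_adjugate_row _ i]
        exact Finset.sum_congr rfl fun j _ => by rw [hMi]
      have hsmul : ∀ u w : MvPolynomial σ R,
          u • Ideal.Quotient.mk I w = Ideal.Quotient.mk I (u * w) := fun u w => rfl
      have hz := sum_smul_eq_zero_of_syzygy (R := R)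
        (fun j => Ideal.Quotient.mk I (M.adjugate j i)) (by
          intro a b
          rw [hsmul, hsmul, ← sub_eq_zero, ← map_sub, Ideal.Quotient.eq_zero_iff_mem]
          exact mul_adjugate_sub_mem I M i (fun j => X j) (fun j _ => hMx j) a b)
        Finset.univ (fun j => N' i j - N i j) (by
          have h1 := congrFun hN i
          have h2 := congrFun hN' i
          simp only [Matrix.mulVec, dotProduct] at h1 h2
          simp only [sub_mul, Finset.sum_sub_distrib, h1, h2, sub_self])
      have hstep : (M.updateRow i (fun j => N' i j)).det - M.det ∈ I := by
        rw [hdet, hdet', ← Finset.sum_sub_distrib, ← Ideal.Quotient.eq_zero_iff_mem, map_sum, ← hz]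
        refine Finset.sum_congr rfl fun j _ => ?_
        rw [hsmul, sub_mul]
      rw [hins]
      have := add_mem hstep ih
      rwa [sub_add_sub_cancel] at this
  have h := main Finset.univ
  have huniv : (Matrix.of fun i j => if i ∈ Finset.univ then N' i j else N i j) = N' := by
    ext i j; simp
  rwa [huniv] at h

end Determinant

/-! ### Functionals given by their values on monomials -/

section Pairing

open MvPolynomial

variable {σ A M : Type*} [CommRing A] [AddCommGroup M] [Module A M]

/-- The linear map on `A[x]` with prescribed values `w e` on the monomials `x^e`. -/
def monomialFunctional (w : (σ →₀ ℕ) → M) : MvPolynomial σ A →ₗ[A] M :=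
  (basisMonomials σ A).constr A w

lemma monomialFunctional_monomial (w : (σ →₀ ℕ) → M) (e : σ →₀ ℕ) (c : A) :
    monomialFunctional w (monomial e c) = c • w e := by
  have h : monomial e c = c • basisMonomials σ A e := by
    rw [coe_basisMonomials, smul_monomial, smul_eq_mul, mul_one]
  rw [monomialFunctional, h, map_smul, Module.Basis.constr_basis]

lemma map_monomialFunctional {B : Type*} [CommRing B] (ψ : A →+* B) (w : (σ →₀ ℕ) → A)
    (f : MvPolynomial σ A) :
    ψ (monomialFunctional w f) = monomialFunctional (fun e => ψ (w e)) (map ψ f) := by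
  induction f using MvPolynomial.induction_on' with
  | monomial e c => simp [monomialFunctional_monomial]
  | add f g hf hg => simp only [map_add, hf, hg]

/-- A linear map vanishing on all products of an element `h` with monomials vanishes on all
multiples of `h`. -/
lemma apply_mul_eq_zero {P : MvPolynomial σ A →ₗ[A] M} {h : MvPolynomial σ A}
    (hP : ∀ u, P (h * monomial u 1) = 0) (q : MvPolynomial σ A) : P (h * q) = 0 := by
  induction q using MvPolynomial.induction_on' with
  | monomial e c =>
    have : h * monomial e c = c • (h * monomial e 1) := by
      rw [smul_eq_C_mul, mul_left_comm, C_mul_monomial, mul_one]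
    rw [this, map_smul, hP, smul_zero]
  | add f g hf hg => rw [mul_add, map_add, hf, hg, add_zero]

lemma apply_eq_zero_of_mem_span {ι : Type*} {P : MvPolynomial σ A →ₗ[A] M}
    {g : ι → MvPolynomial σ A} (hP : ∀ i q, P (g i * q) = 0) {f : MvPolynomial σ A}
    (hf : f ∈ Ideal.span (Set.range g)) : P f = 0 := by
  rw [← Set.image_univ, Ideal.span, Submodule.mem_span_image_iff_exists_fun] at hf
  obtain ⟨t, _, c, rfl⟩ := hf
  rw [map_sum]
  exact Finset.sum_eq_zero fun i _ => by rw [smul_eq_mul, mul_comm, hP]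

end Pairing

/-! ### The generic forms over the polynomial ring -/

section Integral

open MvPolynomial

variable (k : Type*) [Field k] {m : ℕ} (d : Fin m → ℕ)

/-- The generic form `∑_{|r| = d_i} a_{i,r} x^r` with coefficients in `k[a_{i,r}]`. -/
def integralForm (i : Fin m) : MvPolynomial (Fin m) (AuxPoly k d) :=
  ∑ r : {r : Fin m →₀ ℕ // r.degree = d i}, monomial r.1 (X ⟨i, r⟩)

lemma map_integralForm (i : Fin m) :
    map (algebraMap (AuxPoly k d) (AuxField k d)) (integralForm k d i) = genericForm k d i := by
  simp [integralForm, genericForm, auxVar]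

lemma integralForm_isHomogeneous (i : Fin m) : (integralForm k d i).IsHomogeneous (d i) :=
  IsHomogeneous.sum _ _ _ fun r _ => isHomogeneous_monomial _ r.2

lemma genericForm_isHomogeneous (i : Fin m) : (genericForm k d i).IsHomogeneous (d i) :=
  IsHomogeneous.sum _ _ _ fun r _ => isHomogeneous_monomial _ r.2

/-- The point `a` of the parameter space at which the generic forms become `x_i^{d_i}`. -/
def fermatPoint (ι : Index d) : k :=
  if ι.2.1 = Finsupp.single ι.1 (d ι.1) then 1 else 0

/-- The monomial `x_i^{d_i}`, as an index. -/
def powIndex (i : Fin m) : {r : Fin m →₀ ℕ // r.degree = d i} :=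
  ⟨Finsupp.single i (d i), by simp⟩

lemma fermatPoint_mk (i : Fin m) (r : {r : Fin m →₀ ℕ // r.degree = d i}) :
    fermatPoint k d ⟨i, r⟩ = if r = powIndex d i then 1 else 0 := by
  simp [fermatPoint, powIndex, Subtype.ext_iff]

lemma map_eval_integralForm (i : Fin m) :
    map (eval (fermatPoint k d)) (integralForm k d i) = X i ^ d i := by
  classical
  simp only [integralForm, map_sum, map_monomial, eval_X, fermatPoint_mk]
  rw [Finset.sum_eq_single (powIndex d i)]
  · rw [if_pos rfl, X_pow_eq_monomial]; rfl
  · intro r _ hr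
    rw [if_neg hr, monomial_zero]
  · simp

/-- The exponent `(d₁ - 1, …, d_m - 1)`. -/
def socleExponent : Fin m →₀ ℕ := Finsupp.equivFunOnFinite.symm fun i => d i - 1

variable {d}

lemma sum_pred_eq_topDegree (hd : ∀ i, 0 < d i) : ∑ i, (d i - 1) = topDegree d := by
  rw [topDegree, Finset.sum_tsub_distrib _ fun i _ => hd i]
  simp

lemma degree_socleExponent (hd : ∀ i, 0 < d i) : (socleExponent d).degree = topDegree d := by
  rw [Finsupp.degree_eq_sum, ← sum_pred_eq_topDegree hd]
  rfl

/-- A homogeneous matrix with `g = N x` over `k[a_{i,r}]`, which becomes diagonal when the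
generic forms specialize to `x_i^{d_i}`: divide every monomial by some variable occurring
in it. -/
lemma exists_integral_matrix (hd : ∀ i, 0 < d i) :
    ∃ N : Matrix (Fin m) (Fin m) (MvPolynomial (Fin m) (AuxPoly k d)),
      N.mulVec (fun j => X j) = integralForm k d ∧
      (∀ i j, (N i j).IsHomogeneous (d i - 1)) ∧
      (N.map (map (eval (fermatPoint k d))) : Matrix _ _ (MvPolynomial (Fin m) k)) =
        Matrix.diagonal fun i => X i ^ (d i - 1) := by
  classical
  have hex : ∀ (i : Fin m) (r : {r : Fin m →₀ ℕ // r.degree = d i}), ∃ j, r.1 j ≠ 0 := by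
    intro i r
    by_contra! h
    have h0 : r.1 = 0 := Finsupp.ext h
    have := r.2
    rw [h0] at this
    simp only [map_zero] at this
    exact (hd i).ne this
  choose c hc using hex
  have hsub : ∀ i r, r.1 - Finsupp.single (c i r) 1 + Finsupp.single (c i r) 1 = r.1 := by
    intro i r
    refine tsub_add_cancel_of_le ?_
    rw [Finsupp.single_le_iff]
    exact Nat.one_le_iff_ne_zero.2 (hc i r)
  have hpow : ∀ i, c i (powIndex d i) = i := by
    intro i
    by_contra h
    exact hc i (powIndex d i) (Finsupp.single_eq_of_ne h)
  refine ⟨Matrix.of fun i j => ∑ r : {r : Fin m →₀ ℕ // r.degree = d i},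
    if c i r = j then monomial (r.1 - Finsupp.single j 1) (X ⟨i, r⟩) else 0, ?_, ?_, ?_⟩
  · funext i
    simp only [Matrix.mulVec, dotProduct, Matrix.of_apply, Finset.sum_mul, integralForm]
    rw [Finset.sum_comm]
    refine Finset.sum_congr rfl fun r _ => ?_
    rw [Finset.sum_eq_single (c i r)]
    · rw [if_pos rfl, show (X (c i r) : MvPolynomial (Fin m) (AuxPoly k d)) =
        monomial (Finsupp.single (c i r) 1) 1 from rfl, monomial_mul, mul_one, hsub]
    · intro j _ hj
      rw [if_neg (Ne.symm hj), zero_mul]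
    · simp
  · intro i j
    refine IsHomogeneous.sum _ _ _ fun r _ => ?_
    split_ifs with h
    · refine isHomogeneous_monomial _ ?_
      have := congrArg Finsupp.degree (hsub i r)
      rw [map_add, r.2, Finsupp.degree_single, h] at this
      omega
    · exact isHomogeneous_zero _ _ _
  · ext1 i j
    simp only [Matrix.map_apply, Matrix.of_apply, map_sum]
    rw [Finset.sum_eq_single (powIndex d i)]
    · rw [hpow, Matrix.diagonal_apply]
      split_ifs with h
      · subst h
        rw [map_monomial, eval_X, fermatPoint_mk, if_pos rfl, X_pow_eq_monomial]
        congr 1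
        rw [powIndex, ← Finsupp.single_tsub]
      · exact map_zero _
    · intro r _ hr
      split_ifs
      · rw [map_monomial, eval_X, fermatPoint_mk, if_neg hr, monomial_zero]
      · exact map_zero _
    · simp

lemma det_isHomogeneous {A : Type*} [CommRing A]
    (N : Matrix (Fin m) (Fin m) (MvPolynomial (Fin m) A)) (hd : ∀ i, 0 < d i)
    (hN : ∀ i j, (N i j).IsHomogeneous (d i - 1)) : N.det.IsHomogeneous (topDegree d) := by
  rw [Matrix.det_apply]
  refine IsHomogeneous.sum _ _ _ fun τ _ => ?_
  have h : (∏ i, N (τ i) i).IsHomogeneous (∑ i, (d (τ i) - 1)) :=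
    IsHomogeneous.prod _ _ _ fun i _ => hN _ _
  rw [Equiv.sum_comp τ (fun i => d i - 1), sum_pred_eq_topDegree hd] at h
  rcases Int.units_eq_one_or (Equiv.Perm.sign τ) with h1 | h1 <;> rw [h1]
  · simpa using h
  · simpa using h.neg

lemma prod_X_pow_pred (A : Type*) [CommRing A] (f : Fin m → ℕ) :
    ∏ i, (X i : MvPolynomial (Fin m) A) ^ f i =
      monomial (Finsupp.equivFunOnFinite.symm f) 1 := by
  rw [monomial_eq, C_1, one_mul, Finsupp.prod_fintype _ _ (by simp)]
  rfl

/-- The form `x^{t - d_i e_i} g_i` if `i` with `d_i ≤ t_i` exists, and `x^t` for the exponent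
`t = (d₁ - 1, …, d_m - 1)`: these specialize to the monomials of degree `s`. -/
lemma exists_lift (hd : ∀ i, 0 < d i) (t : Fin m →₀ ℕ) (ht : t.degree = topDegree d) :
    ∃ F : MvPolynomial (Fin m) (AuxPoly k d), F.IsHomogeneous (topDegree d) ∧
      map (eval (fermatPoint k d)) F = monomial t 1 ∧
      ((t = socleExponent d ∧ F = monomial t 1) ∨
        (t ≠ socleExponent d ∧ F ∈ Ideal.span (Set.range (integralForm k d)))) := by
  by_cases h : t = socleExponent d
  · exact ⟨monomial t 1, isHomogeneous_monomial _ ht, by simp, Or.inl ⟨h, rfl⟩⟩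
  obtain ⟨i, hi⟩ : ∃ i, d i ≤ t i := by
    by_contra! hlt
    apply h
    have hle : ∀ i ∈ Finset.univ, t i ≤ d i - 1 := fun i _ => Nat.le_pred_of_lt (hlt i)
    have hsum : ∑ i, t i = ∑ i, (d i - 1) := by
      rw [sum_pred_eq_topDegree hd, ← ht, Finsupp.degree_eq_sum]
    ext i
    exact (Finset.sum_eq_sum_iff_of_le hle).1 hsum i (Finset.mem_univ i)
  have hsub : t - Finsupp.single i (d i) + Finsupp.single i (d i) = t :=
    tsub_add_cancel_of_le (Finsupp.single_le_iff.2 hi)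
  refine ⟨monomial (t - Finsupp.single i (d i)) 1 * integralForm k d i, ?_, ?_, Or.inr ⟨h, ?_⟩⟩
  · have := (isHomogeneous_monomial (1 : AuxPoly k d)
      (rfl : (t - Finsupp.single i (d i)).degree = _)).mul (integralForm_isHomogeneous k d i)
    have hdeg := congrArg Finsupp.degree hsub
    rw [map_add, Finsupp.degree_single, ht] at hdeg
    rwa [hdeg] at this
  · rw [map_mul, map_eval_integralForm, map_monomial, map_one, X_pow_eq_monomial, monomial_mul,
      one_mul, hsub]
  · exact Ideal.mul_mem_left _ _ (Ideal.subset_span ⟨i, rfl⟩)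

lemma sum_monomial_coeff_of_isHomogeneous {A : Type*} [CommRing A] {n : ℕ}
    {f : MvPolynomial (Fin m) A} (hf : f.IsHomogeneous n) :
    ∑ t : {t : Fin m →₀ ℕ // t.degree = n}, monomial t.1 (coeff t.1 f) = f := by
  classical
  ext e
  simp only [coeff_sum, coeff_monomial]
  by_cases he : e.degree = n
  · rw [Finset.sum_eq_single ⟨e, he⟩]
    · simp
    · intro t _ ht
      rw [if_neg fun h => ht (Subtype.ext h)]
    · simp
  · rw [hf.coeff_eq_zero he]
    refine Finset.sum_eq_zero fun t _ => if_neg fun h => he ?_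
    rw [← h, t.2]

/-- `A_s` is spanned by the class of `x₁^{d₁-1} ⋯ x_m^{d_m-1}`: the relations that express all
other monomials of degree `s` have a coefficient matrix that specializes to the identity, so it
is invertible over the field of rational functions. -/
lemma exists_proj_eq_smul (hd : ∀ i, 0 < d i) {f : MvPolynomial (Fin m) (AuxField k d)}
    (hf : f.IsHomogeneous (topDegree d)) :
    ∃ c : AuxField k d, proj (genericForm k d) f =
      c • proj (genericForm k d) (monomial (socleExponent d) 1) := by
  classical
  set T := {t : Fin m →₀ ℕ // t.degree = topDegree d}
  choose F hFh hFs hF using fun t : T => exists_lift k hd t.1 t.2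
  set M : Matrix T T (AuxPoly k d) := Matrix.of fun t t' => coeff t'.1 (F t) with hM
  have hspec : M.map (eval (fermatPoint k d)) = 1 := by
    ext t t'
    rw [Matrix.map_apply, hM, Matrix.of_apply, ← coeff_map, hFs, coeff_monomial,
      Matrix.one_apply]
    exact if_congr Subtype.ext_iff.symm rfl rfl
  have hdet : M.det ≠ 0 := by
    intro h
    have h1 := congrArg (eval (fermatPoint k d)) h
    rw [RingHom.map_det, RingHom.mapMatrix_apply, hspec, Matrix.det_one, map_zero] at h1
    exact one_ne_zero h1
  set MK := M.map (algebraMap (AuxPoly k d) (AuxField k d)) with hMK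
  have hunit : IsUnit MK.det := by
    rw [hMK, ← RingHom.mapMatrix_apply, ← RingHom.map_det, isUnit_iff_ne_zero]
    simpa using (IsFractionRing.injective (AuxPoly k d) (AuxField k d)).ne hdet
  set y : T → QuotRing (genericForm k d) := fun t => proj (genericForm k d) (monomial t.1 1)
    with hy
  set t₀ : T := ⟨socleExponent d, degree_socleExponent hd⟩ with ht₀
  have hproj : ∀ q : MvPolynomial (Fin m) (AuxField k d), q.IsHomogeneous (topDegree d) →
      proj (genericForm k d) q = ∑ t : T, coeff t.1 q • y t := by
    intro q hq
    conv_lhs => rw [← sum_monomial_coeff_of_isHomogeneous hq]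
    rw [map_sum]
    refine Finset.sum_congr rfl fun t _ => ?_
    rw [hy, ← map_smul, smul_monomial, smul_eq_mul, mul_one]
  have hrow : ∀ t, ∑ t', MK t t' • y t' = if t = t₀ then y t₀ else 0 := by
    intro t
    have h1 := hproj (map (algebraMap (AuxPoly k d) (AuxField k d)) (F t)) ((hFh t).map _)
    simp only [coeff_map] at h1
    change ∑ t', algebraMap (AuxPoly k d) (AuxField k d) (coeff t'.1 (F t)) • y t' = _
    rw [← h1]
    rcases hF t with ⟨h2, h3⟩ | ⟨h2, h3⟩
    · have : t = t₀ := Subtype.ext h2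
      rw [if_pos this, h3, map_monomial, map_one, ← this]
    · rw [if_neg fun h => h2 (congrArg Subtype.val h)]
      have h4 := Ideal.mem_map_of_mem (map (algebraMap (AuxPoly k d) (AuxField k d))) h3
      rw [Ideal.map_span, ← Set.range_comp] at h4
      refine Ideal.Quotient.eq_zero_iff_mem.2 ?_
      have h5 : genericForm k d =
          map (algebraMap (AuxPoly k d) (AuxField k d)) ∘ integralForm k d :=
        funext fun i => (map_integralForm k d i).symm
      rw [idealOf, h5]
      exact h4
  have hinv : ∀ s, y s = MK⁻¹ s t₀ • y t₀ := by
    intro s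
    have h1 : ∑ t, MK⁻¹ s t • ∑ t', MK t t' • y t' = y s := by
      simp only [Finset.smul_sum, smul_smul]
      rw [Finset.sum_comm]
      simp only [← Finset.sum_smul, ← Matrix.mul_apply]
      rw [Matrix.nonsing_inv_mul _ hunit]
      rw [Finset.sum_eq_single s]
      · rw [Matrix.one_apply_eq, one_smul]
      · intro t _ hts
        rw [Matrix.one_apply_ne hts.symm, zero_smul]
      · exact fun h => absurd (Finset.mem_univ s) h
    rw [← h1, Finset.sum_eq_single t₀]
    · rw [hrow, if_pos rfl]
    · intro t _ ht
      rw [hrow, if_neg ht, smul_zero]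
    · exact fun h => absurd (Finset.mem_univ t₀) h
  refine ⟨∑ t : T, coeff t.1 f * MK⁻¹ t t₀, ?_⟩
  rw [hproj f hf, Finset.sum_smul]
  refine Finset.sum_congr rfl fun t _ => ?_
  rw [hinv t, smul_smul]

end Integral

/-! ### The residue as an expansion around `x_i^{d_i}` -/

section Expansion

open MvPolynomial

variable (k : Type*) [Field k] {m : ℕ} (d : Fin m → ℕ)

/-- The exponent vector with entries `d_i (ν_i + 1) - 1`. -/
def poleExponent (ν : Fin m →₀ ℕ) : Fin m →₀ ℕ :=
  Finsupp.equivFunOnFinite.symm fun i => d i * (ν i + 1) - 1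

/-- The coefficient of `ε^n` in the formal residue of `x^t / ∏ (x_i^{d_i} + ε h_i)`, where `h_i` is
the generic form: expand the denominators into geometric series in `ε h_i / x_i^{d_i}` and take
the coefficient of `x₁⁻¹ ⋯ x_m⁻¹`. -/
def residueCoeff (n : ℕ) (t : Fin m →₀ ℕ) : AuxPoly k d :=
  ∑ ν ∈ Finset.univ.finsuppAntidiag n,
    (-1) ^ n * coeff (poleExponent d ν) (monomial t 1 * ∏ i, integralForm k d i ^ ν i)

/-- The formal residue of `x^t / ∏ (x_i^{d_i} + ε h_i)`. -/
def residueSeries (t : Fin m →₀ ℕ) : PowerSeries (AuxPoly k d) :=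
  PowerSeries.mk fun n => residueCoeff k d n t

lemma residueCoeff_zero (t : Fin m →₀ ℕ) :
    residueCoeff k d 0 t = if t = socleExponent d then 1 else 0 := by
  classical
  have h : poleExponent d 0 = socleExponent d := by
    ext i; simp [poleExponent, socleExponent]
  simp [residueCoeff, h, coeff_monomial]

variable {d}

lemma residueCoeff_zero_add (hd : ∀ i, 0 < d i) (i : Fin m) (u : Fin m →₀ ℕ) :
    residueCoeff k d 0 (u + Finsupp.single i (d i)) = 0 := by
  rw [residueCoeff_zero, if_neg]
  intro h
  have := DFunLike.congr_fun h i
  simp [socleExponent] at this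
  have := hd i
  omega

lemma poleExponent_add_single (hd : ∀ i, 0 < d i) (ν : Fin m →₀ ℕ) (i : Fin m) :
    poleExponent d (ν + Finsupp.single i 1) = Finsupp.single i (d i) + poleExponent d ν := by
  ext j
  rcases eq_or_ne j i with rfl | hj
  · have h1 : d j * (ν j + 1 + 1) = d j + d j * (ν j + 1) := by ring
    have h2 : 0 < d j * (ν j + 1) := Nat.mul_pos (hd j) (Nat.succ_pos _)
    simp only [poleExponent, Finsupp.equivFunOnFinite_symm_apply_apply, Finsupp.add_apply,
      Finsupp.single_eq_same, h1]
    omega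
  · simp [poleExponent, Finsupp.single_eq_of_ne hj]

lemma prod_pow_add_single {B : Type*} [CommRing B] (h : Fin m → B) (ν : Fin m →₀ ℕ)
    (i : Fin m) :
    ∏ j, h j ^ (ν + Finsupp.single i 1 : Fin m →₀ ℕ) j = h i * ∏ j, h j ^ ν j := by
  classical
  simp only [Finsupp.add_apply, pow_add, Finset.prod_mul_distrib]
  rw [mul_comm, Finset.prod_eq_single i (fun j _ hj => by rw [Finsupp.single_eq_of_ne hj, pow_zero])
    (fun hi => absurd (Finset.mem_univ i) hi), Finsupp.single_eq_same, pow_one]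

/-- Multiplication by `x_i^{d_i}` cancels one factor `h_i / x_i^{d_i}` of the expansion. -/
lemma residueCoeff_succ_add (hd : ∀ i, 0 < d i) (n : ℕ) (i : Fin m) (u : Fin m →₀ ℕ) :
    residueCoeff k d (n + 1) (u + Finsupp.single i (d i)) +
      ∑ r : {r : Fin m →₀ ℕ // r.degree = d i}, X ⟨i, r⟩ * residueCoeff k d n (u + r.1) = 0 := by
  classical
  have h1 : ∑ r : {r : Fin m →₀ ℕ // r.degree = d i}, X ⟨i, r⟩ * residueCoeff k d n (u + r.1) =
      ∑ ν ∈ Finset.univ.finsuppAntidiag n, (-1) ^ n * coeff (poleExponent d ν)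
        (monomial u 1 * (integralForm k d i * ∏ j, integralForm k d j ^ ν j)) := by
    simp only [residueCoeff, Finset.mul_sum]
    rw [Finset.sum_comm]
    refine Finset.sum_congr rfl fun ν _ => ?_
    rw [integralForm, Finset.sum_mul, Finset.mul_sum, coeff_sum, Finset.mul_sum]
    refine Finset.sum_congr rfl fun r _ => ?_
    have : (monomial u 1 : MvPolynomial (Fin m) (AuxPoly k d)) * (monomial r.1 (X ⟨i, r⟩) *
        ∏ j, integralForm k d j ^ ν j) =
        C (X ⟨i, r⟩) * (monomial (u + r.1) 1 * ∏ j, integralForm k d j ^ ν j) := by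
      rw [← mul_assoc, ← mul_assoc, monomial_mul, C_mul_monomial, one_mul, mul_one]
    rw [this, coeff_C_mul]
    ring
  have hmem : ∀ (l : ℕ) (ν : Fin m →₀ ℕ),
      ν ∈ Finset.univ.finsuppAntidiag l ↔ ν.degree = l := by
    intro l ν
    rw [Finset.mem_finsuppAntidiag, Finsupp.degree_eq_sum]
    exact and_iff_left (Finset.subset_univ _)
  have h2 : residueCoeff k d (n + 1) (u + Finsupp.single i (d i)) =
      ∑ ν ∈ Finset.univ.finsuppAntidiag n, (-1) ^ (n + 1) * coeff (poleExponent d ν)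
        (monomial u 1 * (integralForm k d i * ∏ j, integralForm k d j ^ ν j)) := by
    rw [residueCoeff]
    have hmon : ∀ q : MvPolynomial (Fin m) (AuxPoly k d),
        monomial (u + Finsupp.single i (d i)) 1 * q =
          monomial (Finsupp.single i (d i)) 1 * (monomial u 1 * q) := by
      intro q
      rw [← mul_assoc, monomial_mul, one_mul, add_comm]
    symm
    refine Finset.sum_of_injOn (fun ν => ν + Finsupp.single i 1) ?_ ?_ ?_ ?_
    · exact (add_left_injective _).injOn
    · intro ν hν
      rw [Finset.mem_coe, hmem] at hν ⊢
      rw [map_add, hν, Finsupp.degree_single]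
    · intro ν hν hν'
      -- if `ν i = 0`, then the exponent of `x_i` in question is `d_i - 1`
      have hνi : ν i = 0 := by
        by_contra hne
        have hsub : ν - Finsupp.single i 1 + Finsupp.single i 1 = ν :=
          tsub_add_cancel_of_le (Finsupp.single_le_iff.2 (Nat.one_le_iff_ne_zero.2 hne))
        refine hν' ⟨ν - Finsupp.single i 1, ?_, hsub⟩
        rw [hmem, ← hsub, map_add, Finsupp.degree_single] at hν
        rw [Finset.mem_coe, hmem]
        exact Nat.succ_injective hν
      rw [hmon, coeff_monomial_mul', if_neg, mul_zero]
      intro hle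
      have := hle i
      have hdi := hd i
      simp only [Finsupp.single_eq_same, poleExponent, Finsupp.equivFunOnFinite_symm_apply_apply,
        hνi] at this
      omega
    · intro ν _
      rw [poleExponent_add_single hd, hmon, coeff_monomial_mul, one_mul,
        prod_pow_add_single]
  rw [h1, h2, ← Finset.sum_add_distrib]
  exact Finset.sum_eq_zero fun ν _ => by ring

variable (d)

/-- The substitution `a ↦ a₀ + ε a`, with `a₀` the point where the generic forms become
`x_i^{d_i}`. -/
def deformPoly : AuxPoly k d →+* Polynomial (AuxPoly k d) :=
  eval₂Hom (Polynomial.C.comp MvPolynomial.C) fun ι =>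
    Polynomial.C (C (fermatPoint k d ι)) + Polynomial.X * Polynomial.C (X ι)

/-- The substitution `a ↦ a₀ + ε a`, with values in power series in `ε`. -/
def deform : AuxPoly k d →+* PowerSeries (AuxPoly k d) :=
  Polynomial.coeToPowerSeries.ringHom.comp (deformPoly k d)

lemma deform_X (ι : Index d) : deform k d (X ι) =
    PowerSeries.C (C (fermatPoint k d ι)) + PowerSeries.X * PowerSeries.C (X ι) := by
  simp only [deform, deformPoly, RingHom.comp_apply, coe_eval₂Hom, eval₂_X, map_add, map_mul,
    Polynomial.coeToPowerSeries.ringHom_apply, Polynomial.coe_C, Polynomial.coe_X]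

/-- Setting `ε = 1` and translating back inverts the substitution `a ↦ a₀ + ε a`. -/
lemma deform_injective : Function.Injective (deform k d) := by
  have h1 : Function.Injective (deformPoly k d) := by
    have h : ((eval₂Hom MvPolynomial.C fun ι => X ι - C (fermatPoint k d ι)).comp
        (Polynomial.evalRingHom 1)).comp (deformPoly k d) = RingHom.id (AuxPoly k d) := by
      refine MvPolynomial.ringHom_ext ?_ ?_
      · intro c; simp [deformPoly]
      · intro ι; simp [deformPoly]
    exact Function.LeftInverse.injective (g := (eval₂Hom MvPolynomial.C
      fun ι => X ι - C (fermatPoint k d ι)).comp (Polynomial.evalRingHom 1))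
      fun x => DFunLike.congr_fun h x
  intro x y hxy
  exact h1 (Polynomial.coe_injective _ hxy)

lemma constantCoeff_comp_deform : (PowerSeries.constantCoeff).comp (deform k d) =
    (C : k →+* AuxPoly k d).comp (eval (fermatPoint k d)) := by
  refine MvPolynomial.ringHom_ext ?_ ?_
  · intro c; simp [deform, deformPoly]
  · intro ι; simp [deform_X]

variable {d}

/-- The formal residue vanishes on the multiples of the deformed forms. -/
lemma sum_deform_mul_residueSeries (hd : ∀ i, 0 < d i) (i : Fin m) (u : Fin m →₀ ℕ) :
    ∑ r : {r : Fin m →₀ ℕ // r.degree = d i},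
      deform k d (X ⟨i, r⟩) * residueSeries k d (u + r.1) = 0 := by
  classical
  have h1 : ∑ r : {r : Fin m →₀ ℕ // r.degree = d i},
      PowerSeries.C (C (fermatPoint k d ⟨i, r⟩)) * residueSeries k d (u + r.1) =
        residueSeries k d (u + Finsupp.single i (d i)) := by
    rw [Finset.sum_eq_single (powIndex d i)]
    · simp [fermatPoint_mk, powIndex]
    · intro r _ hr
      rw [fermatPoint_mk, if_neg hr, map_zero, map_zero, zero_mul]
    · simp
  simp only [deform_X, add_mul, Finset.sum_add_distrib, h1, mul_assoc]
  rw [← Finset.mul_sum]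
  ext1 n
  cases n with
  | zero => simp [residueSeries, residueCoeff_zero_add k hd]
  | succ n =>
    rw [map_add, PowerSeries.coeff_succ_X_mul, map_sum]
    simp only [PowerSeries.coeff_C_mul, residueSeries, PowerSeries.coeff_mk, map_zero]
    exact residueCoeff_succ_add k hd n i u

/-- An injective homomorphism between domains extends to their fraction fields. -/
lemma exists_extension {A K S L : Type*} [CommRing A] [Field K] [Algebra A K]
    [IsFractionRing A K] [CommRing S] [Field L] [Algebra S L] [IsFractionRing S L]
    (f : A →+* S) (hf : Function.Injective f) :
    ∃ ψ : K →+* L, ψ.comp (algebraMap A K) = (algebraMap S L).comp f := by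
  have hinj : Function.Injective ((algebraMap S L).comp f) :=
    (IsFractionRing.injective S L).comp hf
  exact ⟨IsFractionRing.lift hinj, RingHom.ext fun x => IsFractionRing.lift_algebraMap hinj x⟩

/-- Nonvanishing of the determinant, with respect to any field `L` that contains both the power
series in `ε` and, through the substitution `a ↦ a₀ + ε a`, the field of rational functions. -/
lemma map_det_notMem_of_extension {L : Type*} [Field L] (j : PowerSeries (AuxPoly k d) →+* L)
    (hj : Function.Injective j) (ψ : AuxField k d →+* L)
    (hψ : ψ.comp (algebraMap (AuxPoly k d) (AuxField k d)) = j.comp (deform k d)) (hd : ∀ i, 0 < d i)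
    (N : Matrix (Fin m) (Fin m) (MvPolynomial (Fin m) (AuxPoly k d)))
    (hN : (N.map (map (eval (fermatPoint k d))) : Matrix _ _ (MvPolynomial (Fin m) k)) =
      Matrix.diagonal fun i => X i ^ (d i - 1)) :
    map (algebraMap (AuxPoly k d) (AuxField k d)) N.det ∉ idealOf (genericForm k d) := by
  intro hmem
  set w : (Fin m →₀ ℕ) → L := fun t => j (residueSeries k d t)
  have hkill : ∀ i q, monomialFunctional w (map ψ (genericForm k d i) * q) = 0 := by
    intro i q
    refine apply_mul_eq_zero (fun u => ?_) q
    rw [← map_integralForm, map_map, hψ, integralForm]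
    simp only [map_sum, map_monomial, Finset.sum_mul, monomial_mul, mul_one,
      monomialFunctional_monomial, smul_eq_mul, RingHom.comp_apply]
    rw [← map_zero j, ← sum_deform_mul_residueSeries k hd i u,
      map_sum]
    refine Finset.sum_congr rfl fun r _ => ?_
    rw [map_mul, add_comm]
  have h1 := Ideal.mem_map_of_mem (map ψ) hmem
  rw [idealOf, Ideal.map_span, ← Set.range_comp] at h1
  have h2 := apply_eq_zero_of_mem_span hkill h1
  rw [map_map, hψ, ← map_map, ← map_monomialFunctional] at h2
  have h3 := (map_eq_zero_iff j hj).1 h2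
  have h4 := congrArg PowerSeries.constantCoeff h3
  rw [map_monomialFunctional, map_map, constantCoeff_comp_deform, ← map_map, RingHom.map_det,
    RingHom.mapMatrix_apply, hN, Matrix.det_diagonal, prod_X_pow_pred, map_monomial, map_one,
    monomialFunctional_monomial, one_smul, map_zero] at h4
  have h5 := residueCoeff_zero k d (socleExponent d)
  rw [if_pos rfl] at h5
  refine one_ne_zero (α := AuxPoly k d) ?_
  rw [← h5, ← h4]
  simp [residueSeries, socleExponent]

/-- The determinant of an integral matrix `N` with `g = N x` that specializes to
`diag (x_i^{d_i - 1})` is nonzero in `A`: its formal residue is `1` modulo `ε`. -/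
lemma map_det_notMem (hd : ∀ i, 0 < d i)
    (N : Matrix (Fin m) (Fin m) (MvPolynomial (Fin m) (AuxPoly k d)))
    (hN : (N.map (map (eval (fermatPoint k d))) : Matrix _ _ (MvPolynomial (Fin m) k)) =
      Matrix.diagonal fun i => X i ^ (d i - 1)) :
    map (algebraMap (AuxPoly k d) (AuxField k d)) N.det ∉ idealOf (genericForm k d) := by
  obtain ⟨ψ, hψ⟩ := exists_extension (K := AuxField k d)
    (L := FractionRing (PowerSeries (AuxPoly k d))) (deform k d) (deform_injective k d)
  exact map_det_notMem_of_extension k _ (IsFractionRing.injective _ _) ψ hψ hd N hN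

end Expansion

/-! ### The residue map -/

section ResidueMap

open MvPolynomial

variable {k : Type*} [Field k] {m : ℕ} {d : Fin m → ℕ}

lemma exists_matrix (hd : ∀ i, 0 < d i) :
    ∃ N : Matrix (Fin m) (Fin m) (MvPolynomial (Fin m) (AuxField k d)),
      N.mulVec (fun j => X j) = genericForm k d ∧ N.det.IsHomogeneous (topDegree d) ∧
        N.det ∉ idealOf (genericForm k d) := by
  obtain ⟨N, hNx, hNh, hNs⟩ := exists_integral_matrix k hd
  set φ := map (σ := Fin m) (algebraMap (AuxPoly k d) (AuxField k d))
  have hdet : (N.map φ).det = φ N.det := by rw [RingHom.map_det, RingHom.mapMatrix_apply]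
  refine ⟨N.map φ, ?_, ?_, ?_⟩
  · funext i
    have := congrArg φ (congrFun hNx i)
    rw [map_integralForm] at this
    rw [← this]
    simp [Matrix.mulVec, dotProduct, φ]
  · rw [hdet]
    exact (det_isHomogeneous N hd hNh).map _
  · rw [hdet]
    exact map_det_notMem k hd N hNs

lemma proj_eq_zero_iff {F : Type*} [Field F] {g : Fin m → MvPolynomial (Fin m) F}
    {f : MvPolynomial (Fin m) F} : proj g f = 0 ↔ f ∈ idealOf g :=
  Ideal.Quotient.eq_zero_iff_mem

/-- `A_s` is spanned by any of its nonzero elements. -/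
lemma exists_eq_smul_of_mem_gradedPiece (hd : ∀ i, 0 < d i)
    {v w : QuotRing (genericForm k d)} (hv : v ∈ gradedPiece (genericForm k d) (topDegree d))
    (hw : w ∈ gradedPiece (genericForm k d) (topDegree d)) (hv0 : v ≠ 0) :
    ∃ c : AuxField k d, w = c • v := by
  obtain ⟨f, hf, rfl⟩ := hv
  obtain ⟨f', hf', rfl⟩ := hw
  obtain ⟨c, hc⟩ := exists_proj_eq_smul k hd ((mem_homogeneousSubmodule _ _).1 hf)
  obtain ⟨c', hc'⟩ := exists_proj_eq_smul k hd ((mem_homogeneousSubmodule _ _).1 hf')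
  simp only [AlgHom.toLinearMap_apply] at hv0 ⊢
  rw [hc] at hv0
  have hc0 : c ≠ 0 := fun h => hv0 (by rw [h, zero_smul])
  refine ⟨c' / c, ?_⟩
  rw [hc, hc', smul_smul, div_mul_cancel₀ _ hc0]

lemma exists_linearEquiv_apply_one {K V : Type*} [Field K] [AddCommGroup V] [Module K V] {v : V}
    (hv : v ≠ 0) (hspan : ∀ w, ∃ c : K, w = c • v) : ∃ e : K ≃ₗ[K] V, e 1 = v := by
  refine ⟨LinearEquiv.ofBijective (LinearMap.toSpanSingleton K V v)
    ⟨LinearMap.ker_eq_bot.1 (LinearMap.ker_toSpanSingleton _ hv), fun w => ?_⟩, ?_⟩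
  · obtain ⟨c, hc⟩ := hspan w
    exact ⟨c, by rw [hc, LinearMap.toSpanSingleton_apply]⟩
  · exact one_smul K v

theorem existsUnique_isResidueMap (hd : ∀ i, 0 < d i) :
    ∃! vol : gradedPiece (genericForm k d) (topDegree d) ≃ₗ[AuxField k d] AuxField k d,
      IsResidueMap (genericForm k d) (topDegree d) vol := by
  obtain ⟨N, hNx, hNh, hN0⟩ := exists_matrix (k := k) hd
  have hmem : proj (genericForm k d) N.det ∈ gradedPiece (genericForm k d) (topDegree d) :=
    ⟨N.det, (mem_homogeneousSubmodule _ _).2 hNh, rfl⟩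
  set v : gradedPiece (genericForm k d) (topDegree d) := ⟨proj (genericForm k d) N.det, hmem⟩
  have hv0 : v ≠ 0 := fun h => hN0 (proj_eq_zero_iff.1 (congrArg Subtype.val h))
  have hspan : ∀ w : gradedPiece (genericForm k d) (topDegree d),
      ∃ c : AuxField k d, w = c • v := by
    intro w
    obtain ⟨c, hc⟩ := exists_eq_smul_of_mem_gradedPiece hd v.2 w.2
      (fun h => hv0 (Subtype.ext h))
    exact ⟨c, Subtype.ext hc⟩
  obtain ⟨e, he1⟩ := exists_linearEquiv_apply_one hv0 hspan
  refine ⟨e.symm, ?_, ?_⟩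
  · intro N' hN'
    have h : proj (genericForm k d) N'.det = proj (genericForm k d) N.det := by
      rw [← sub_eq_zero, ← map_sub, proj_eq_zero_iff]
      exact det_sub_det_mem _ N N' hNx hN'
    refine ⟨by rw [h]; exact hmem, ?_⟩
    have h' : (⟨proj (genericForm k d) N'.det, by rw [h]; exact hmem⟩ :
        gradedPiece (genericForm k d) (topDegree d)) = v := Subtype.ext h
    rw [h', ← he1, LinearEquiv.symm_apply_apply]
  · intro vol hvol
    obtain ⟨_, hv1⟩ := hvol N hNx
    refine LinearEquiv.ext fun w => ?_
    obtain ⟨c, rfl⟩ := hspan w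
    rw [map_smul, map_smul, ← he1, LinearEquiv.symm_apply_apply, he1]
    exact congrArg _ hv1

variable {F : Type*} [Field F] (g : Fin m → MvPolynomial (Fin m) F) (n : ℕ)

/-- The functional `vol ∘ π` on the forms of degree `n`, extended by zero to the forms of other
degrees. -/
def volFunctional (vol : gradedPiece g n ≃ₗ[F] F) : MvPolynomial (Fin m) F →ₗ[F] F :=
  vol.toLinearMap ∘ₗ projDeg g n ∘ₗ (homogeneousComponent n).codRestrict
    (homogeneousSubmodule (Fin m) F n)
    fun f => (mem_homogeneousSubmodule _ _).2 (homogeneousComponent_isHomogeneous n f)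

variable {g n}

lemma volFunctional_of_mem (vol : gradedPiece g n ≃ₗ[F] F) (f : MvPolynomial (Fin m) F)
    (hf : f ∈ homogeneousSubmodule (Fin m) F n) :
    volFunctional g n vol f = vol (projDeg g n ⟨f, hf⟩) := by
  change vol (projDeg g n ⟨homogeneousComponent n f, _⟩) = _
  congr 3
  rw [homogeneousComponent_of_mem hf, if_pos rfl]

lemma volFunctional_mul_eq_zero (vol : gradedPiece g n ≃ₗ[F] F)
    (hg : ∀ i, (g i).IsHomogeneous (d i)) (i : Fin m) (q : MvPolynomial (Fin m) F) :
    volFunctional g n vol (g i * q) = 0 := by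
  refine apply_mul_eq_zero (fun u => ?_) q
  have hh : (g i * monomial u 1).IsHomogeneous (d i + u.degree) :=
    (hg i).mul (isHomogeneous_monomial 1 rfl)
  by_cases h : d i + u.degree = n
  · rw [volFunctional_of_mem vol _ ((mem_homogeneousSubmodule _ _).2 (h ▸ hh))]
    rw [show projDeg g n ⟨g i * monomial u 1, (mem_homogeneousSubmodule _ _).2 (h ▸ hh)⟩ = 0 from
      Subtype.ext (proj_eq_zero_iff.2
        (Ideal.mul_mem_right _ _ (Ideal.subset_span ⟨i, rfl⟩))), map_zero]
  · have h0 : homogeneousComponent n (g i * monomial u 1) = 0 := by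
      rw [homogeneousComponent_of_mem ((mem_homogeneousSubmodule _ _).2 hh), if_neg (Ne.symm h)]
    change vol (projDeg g n ⟨homogeneousComponent n (g i * monomial u 1), _⟩) = 0
    simp only [h0]
    exact (vol.toLinearMap ∘ₗ projDeg g n).map_zero

/-- A functional that vanishes on the ideal and takes the value `1` on a determinant
normalizing `vol` agrees with `vol` in degree `n`. -/
lemma volFunctional_eq_of_det (vol : gradedPiece g n ≃ₗ[F] F) (hvol : IsResidueMap g n vol)
    {N : Matrix (Fin m) (Fin m) (MvPolynomial (Fin m) F)}
    (hN : N.mulVec (fun j => X j) = g) (hNh : N.det.IsHomogeneous n)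
    (P : MvPolynomial (Fin m) F →ₗ[F] F) (hP : ∀ i q, P (g i * q) = 0) (hP1 : P N.det = 1)
    (f : MvPolynomial (Fin m) F) (hf : f ∈ homogeneousSubmodule (Fin m) F n) :
    volFunctional g n vol f = P f := by
  obtain ⟨_, h1⟩ := hvol N hN
  have hN' := (mem_homogeneousSubmodule _ _).2 hNh
  set c := volFunctional g n vol f with hc
  have hmem : f - c • N.det ∈ homogeneousSubmodule (Fin m) F n :=
    sub_mem hf (Submodule.smul_mem _ _ hN')
  have hz : vol (projDeg g n ⟨f - c • N.det, hmem⟩) = 0 := by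
    rw [← volFunctional_of_mem, map_sub, map_smul, volFunctional_of_mem vol N.det hN', ← hc]
    rw [show vol (projDeg g n ⟨N.det, hN'⟩) = 1 from h1, smul_eq_mul, mul_one, sub_self]
  have hz' := (LinearEquiv.map_eq_zero_iff vol).1 hz
  have hideal : f - c • N.det ∈ Ideal.span (Set.range g) :=
    proj_eq_zero_iff.1 (congrArg Subtype.val hz')
  have := apply_eq_zero_of_mem_span hP hideal
  rw [map_sub, map_smul, hP1, smul_eq_mul, mul_one, sub_eq_zero] at this
  exact this.symm

end ResidueMap

/-! ### Frobenius descent of functionals -/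

section Frobenius

open MvPolynomial

variable {F : Type*} [Field F] {m : ℕ}

/-- The functional `x^{p u + (p-1)𝟏} ↦ (V x^u)^p`, which kills all other monomials. For
`V = vol ∘ π` this is the residue with respect to `g₁^p, …, g_m^p`. -/
def frobeniusFunctional (p : ℕ) (V : MvPolynomial (Fin m) F →ₗ[F] F) :
    MvPolynomial (Fin m) F →ₗ[F] F :=
  monomialFunctional fun e =>
    if ∀ j, e j % p = p - 1 then
      V (monomial (Finsupp.equivFunOnFinite.symm fun j => e j / p) 1) ^ p
    else 0

lemma frobeniusFunctional_monomial (p : ℕ) (V : MvPolynomial (Fin m) F →ₗ[F] F)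
    (e : Fin m →₀ ℕ) : frobeniusFunctional p V (monomial e 1) =
      if ∀ j, e j % p = p - 1 then
        V (monomial (Finsupp.equivFunOnFinite.symm fun j => e j / p) 1) ^ p
      else 0 := by
  rw [frobeniusFunctional, monomialFunctional_monomial, one_smul]

variable {p : ℕ} [Fact p.Prime] [CharP F p]

lemma frobeniusFunctional_pow_mul_monomial (V : MvPolynomial (Fin m) F →ₗ[F] F)
    (h : MvPolynomial (Fin m) F) (u : Fin m →₀ ℕ) :
    frobeniusFunctional p V (h ^ p * monomial u 1) =
      if ∀ j, u j % p = p - 1 then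
        V (h * monomial (Finsupp.equivFunOnFinite.symm fun j => u j / p) 1) ^ p
      else 0 := by
  have hp : 0 < p := (Fact.out : p.Prime).pos
  induction h using MvPolynomial.induction_on' with
  | monomial e c =>
    have h1 : (monomial e c) ^ p * monomial u 1 = c ^ p • monomial (p • e + u) (1 : F) := by
      rw [monomial_pow, monomial_mul, smul_monomial, smul_eq_mul]
    have h2 : ∀ v : Fin m →₀ ℕ, monomial e c * monomial v 1 = c • monomial (e + v) (1 : F) := by
      intro v
      rw [monomial_mul, smul_monomial, smul_eq_mul]
    have h3 : (∀ j, (p • e + u) j % p = p - 1) ↔ ∀ j, u j % p = p - 1 := by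
      simp
    have h4 : (Finsupp.equivFunOnFinite.symm fun j => (p • e + u) j / p) =
        e + Finsupp.equivFunOnFinite.symm fun j => u j / p := by
      ext j
      simp [Nat.mul_add_div hp]
    rw [h1, h2, map_smul, map_smul, frobeniusFunctional_monomial, h4, smul_eq_mul, smul_eq_mul,
      mul_pow]
    simp only [h3]
    split_ifs <;> simp
  | add f g hf hg =>
    rw [add_pow_char, add_mul, map_add, hf, hg, add_mul, map_add]
    split_ifs
    · rw [add_pow_char]
    · rw [add_zero]

lemma frobeniusFunctional_pow_mul_eq_zero {V : MvPolynomial (Fin m) F →ₗ[F] F}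
    {h : MvPolynomial (Fin m) F} (hV : ∀ q, V (h * q) = 0) (q : MvPolynomial (Fin m) F) :
    frobeniusFunctional p V (h ^ p * q) = 0 := by
  refine apply_mul_eq_zero (fun u => ?_) q
  rw [frobeniusFunctional_pow_mul_monomial, hV, zero_pow (Fact.out : p.Prime).ne_zero, ite_self]

lemma frobeniusFunctional_pow_mul_prod (V : MvPolynomial (Fin m) F →ₗ[F] F)
    (h : MvPolynomial (Fin m) F) :
    frobeniusFunctional p V (h ^ p * ∏ j, X j ^ (p - 1)) = V h ^ p := by
  have hp : 0 < p := (Fact.out : p.Prime).pos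
  rw [prod_X_pow_pred, frobeniusFunctional_pow_mul_monomial, if_pos]
  · have : (Finsupp.equivFunOnFinite.symm fun j : Fin m =>
        (Finsupp.equivFunOnFinite.symm fun _ : Fin m => p - 1) j / p) = 0 := by
      ext j
      simp [Nat.div_eq_of_lt (Nat.sub_lt hp one_pos)]
    rw [this, monomial_zero', C_1, mul_one]
  · intro j
    simp [Nat.mod_eq_of_lt (Nat.sub_lt hp one_pos)]

/-- Two matrices express `g^p` through the variables: the one with entries `g_i^{p-1} N_{ij}` and
the one with entries `N_{ij}^p x_j^{p-1}`. So their determinants agree modulo `(g^p)`. -/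
lemma det_mul_prod_sub_mem {g : Fin m → MvPolynomial (Fin m) F}
    {N : Matrix (Fin m) (Fin m) (MvPolynomial (Fin m) F)}
    (hN : N.mulVec (fun j => X j) = g) :
    N.det * ∏ i, g i ^ (p - 1) - N.det ^ p * ∏ j, X j ^ (p - 1) ∈
      Ideal.span (Set.range fun i => g i ^ p) := by
  have hp : p - 1 + 1 = p := Nat.succ_pred_eq_of_pos (Fact.out : p.Prime).pos
  have hrow : ∀ i, ∑ j, N i j * X j = g i := fun i => congrFun hN i
  have h1 : (Matrix.of fun i j => X j ^ (p - 1) * (N.map (frobenius _ p)) i j).mulVec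
      (fun j => X j) = fun i => g i ^ p := by
    funext i
    simp only [Matrix.mulVec, dotProduct, Matrix.of_apply, Matrix.map_apply]
    rw [← hrow i, ← frobenius_def, map_sum]
    refine Finset.sum_congr rfl fun j _ => ?_
    rw [map_mul, frobenius_def _ (X j)]
    rw [show (X j : MvPolynomial (Fin m) F) ^ p = X j ^ (p - 1) * X j by rw [← pow_succ, hp]]
    ring
  have h2 : (Matrix.of fun i j => g i ^ (p - 1) * N i j).mulVec (fun j => X j) =
      fun i => g i ^ p := by
    funext i
    simp only [Matrix.mulVec, dotProduct, Matrix.of_apply, mul_assoc]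
    rw [← Finset.mul_sum, hrow, ← pow_succ, hp]
  have h := det_sub_det_mem _ _ _ h1 h2
  rw [Matrix.det_mul_column, Matrix.det_mul_row, ← RingHom.mapMatrix_apply, ← RingHom.map_det,
    frobenius_def] at h
  rwa [mul_comm N.det, mul_comm (N.det ^ p)]

/-- The residue map in characteristic `p` is invariant under Frobenius descent: multiply by
`∏ g_i^{p-1}` and take the residue with respect to `g₁^p, …, g_m^p`. -/
theorem volFunctional_eq_frobeniusFunctional {g : Fin m → MvPolynomial (Fin m) F} {n : ℕ}
    {d : Fin m → ℕ} (hg : ∀ i, (g i).IsHomogeneous (d i)) (vol : gradedPiece g n ≃ₗ[F] F)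
    (hvol : IsResidueMap g n vol) {N : Matrix (Fin m) (Fin m) (MvPolynomial (Fin m) F)}
    (hN : N.mulVec (fun j => X j) = g) (hNh : N.det.IsHomogeneous n)
    (f : MvPolynomial (Fin m) F) (hf : f ∈ homogeneousSubmodule (Fin m) F n) :
    volFunctional g n vol f =
      frobeniusFunctional p (volFunctional g n vol) (f * ∏ i, g i ^ (p - 1)) := by
  classical
  have hp : p - 1 + 1 = p := Nat.succ_pred_eq_of_pos (Fact.out : p.Prime).pos
  have hV := fun i q => volFunctional_mul_eq_zero vol hg i q
  have hθ : ∀ i q, frobeniusFunctional p (volFunctional g n vol) (g i ^ p * q) = 0 :=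
    fun i q => frobeniusFunctional_pow_mul_eq_zero (hV i) q
  refine volFunctional_eq_of_det vol hvol hN hNh
    (frobeniusFunctional p (volFunctional g n vol) ∘ₗ
      (LinearMap.mulRight F (∏ i, g i ^ (p - 1)))) ?_ ?_ f hf
  · intro i q
    have h1 : g i * q * ∏ j, g j ^ (p - 1) =
        g i ^ p * (q * ∏ j ∈ Finset.univ.erase i, g j ^ (p - 1)) := by
      rw [← Finset.mul_prod_erase _ _ (Finset.mem_univ i)]
      rw [show g i ^ p = g i ^ (p - 1) * g i by rw [← pow_succ, hp]]
      ring
    rw [LinearMap.comp_apply, LinearMap.mulRight_apply, h1, hθ]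
  · have h2 := apply_eq_zero_of_mem_span hθ (det_mul_prod_sub_mem (p := p) hN)
    obtain ⟨_, h3⟩ := hvol N hN
    have h4 : volFunctional g n vol N.det = 1 := by
      rw [volFunctional_of_mem vol _ ((mem_homogeneousSubmodule _ _).2 hNh)]
      exact h3
    rw [map_sub, sub_eq_zero, frobeniusFunctional_pow_mul_prod, h4, one_pow] at h2
    rw [LinearMap.comp_apply, LinearMap.mulRight_apply, h2]

end Frobenius

/-! ### Coefficientwise derivatives -/

section CoeffDeriv

open MvPolynomial

variable {k F σ : Type*} [Field k] [Field F] [Algebra k F]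

/-- `f'` arises from `f` by applying the derivation `D` to all coefficients. -/
def IsCoeffDeriv (D : Derivation k F F) (f f' : MvPolynomial σ F) : Prop :=
  ∀ t, coeff t f' = D (coeff t f)

namespace IsCoeffDeriv

variable {D : Derivation k F F} {f f' g g' : MvPolynomial σ F}

lemma mul (hf : IsCoeffDeriv D f f') (hg : IsCoeffDeriv D g g') :
    IsCoeffDeriv D (f * g) (f * g' + f' * g) := by
  classical
  intro t
  rw [coeff_add, coeff_mul, coeff_mul, coeff_mul, map_sum, ← Finset.sum_add_distrib]
  refine Finset.sum_congr rfl fun x _ => ?_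
  rw [D.leibniz, hf, hg, smul_eq_mul, smul_eq_mul, mul_comm (D (coeff x.1 f))]

lemma monomial_one (t : σ →₀ ℕ) : IsCoeffDeriv D (monomial t 1) 0 := by
  classical
  intro u
  rw [coeff_monomial, coeff_zero]
  split_ifs
  · rw [D.map_one_eq_zero]
  · rw [map_zero]

lemma one : IsCoeffDeriv D (1 : MvPolynomial σ F) 0 := monomial_one 0

lemma pow (hf : IsCoeffDeriv D f f') (n : ℕ) :
    IsCoeffDeriv D (f ^ n) (n • (f ^ (n - 1) * f')) := by
  induction n with
  | zero => simpa using one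
  | succ n ih =>
    have h := ih.mul hf
    rw [← pow_succ] at h
    convert h using 1
    rcases Nat.eq_zero_or_pos n with rfl | hn
    · simp
    · obtain ⟨l, rfl⟩ := Nat.exists_eq_succ_of_ne_zero hn.ne'
      simp only [Nat.succ_eq_add_one, Nat.add_sub_cancel, nsmul_eq_mul]
      push_cast
      ring

lemma prod_zero {ι : Type*} (S : Finset ι) (h : ι → MvPolynomial σ F)
    (hh : ∀ i ∈ S, IsCoeffDeriv D (h i) 0) : IsCoeffDeriv D (∏ i ∈ S, h i) 0 := by
  classical
  induction S using Finset.induction_on with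
  | empty => simpa using one
  | insert a S ha ih =>
    rw [Finset.prod_insert ha]
    have := (hh a (Finset.mem_insert_self a S)).mul
      (ih fun i hi => hh i (Finset.mem_insert_of_mem hi))
    simpa using this

end IsCoeffDeriv

lemma monomialFunctional_eq_sum {A M : Type*} [CommRing A] [AddCommGroup M] [Module A M]
    (w : (σ →₀ ℕ) → M) (f : MvPolynomial σ A) :
    monomialFunctional w f = ∑ t ∈ f.support, coeff t f • w t := by
  conv_lhs => rw [← support_sum_monomial_coeff f]
  rw [map_sum]
  exact Finset.sum_congr rfl fun t _ => monomialFunctional_monomial _ _ _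

/-- A derivation passes through a functional whose values on monomials are constants. -/
lemma derivation_monomialFunctional {D : Derivation k F F} {w : (σ →₀ ℕ) → F}
    (hw : ∀ t, D (w t) = 0) {f f' : MvPolynomial σ F} (h : IsCoeffDeriv D f f') :
    D (monomialFunctional w f) = monomialFunctional w f' := by
  have hsub : f'.support ⊆ f.support := by
    intro t ht
    rw [mem_support_iff] at ht ⊢
    intro h0
    exact ht (by rw [h t, h0, map_zero])
  rw [monomialFunctional_eq_sum, monomialFunctional_eq_sum, map_sum,
    Finset.sum_subset hsub fun t _ ht => by rw [notMem_support_iff.1 ht, zero_smul]]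
  refine Finset.sum_congr rfl fun t _ => ?_
  rw [smul_eq_mul, D.leibniz, hw, smul_zero, zero_add, smul_eq_mul, smul_eq_mul, h t, mul_comm]

lemma derivation_frobeniusFunctional {m p : ℕ} [CharP F p] (D : Derivation k F F)
    (V : MvPolynomial (Fin m) F →ₗ[F] F) {f f' : MvPolynomial (Fin m) F}
    (h : IsCoeffDeriv D f f') :
    D (frobeniusFunctional p V f) = frobeniusFunctional p V f' := by
  refine derivation_monomialFunctional (fun t => ?_) h
  split_ifs
  · rw [D.leibniz_pow, ← Nat.cast_smul_eq_nsmul F, CharP.cast_eq_zero, zero_smul]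
  · exact map_zero D

end CoeffDeriv

/-! ### Differentiating the products of the generic forms -/

section Differentiation

open MvPolynomial

variable {k : Type*} [Field k] {m : ℕ} {d : Fin m → ℕ}

lemma isCoeffDeriv_genericForm (ι : Index d) :
    IsCoeffDeriv (partialDeriv (k := k) ι) (genericForm k d ι.1) (monomial ι.2.1 1) := by
  classical
  intro t
  rw [genericForm, coeff_sum, map_sum, Finset.sum_eq_single ι.2]
  · simp only [coeff_monomial]
    split_ifs
    · rw [auxVar, partialDeriv_algebraMap, pderiv_X_self, map_one]
    · rw [map_zero]
  · intro r _ hr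
    rw [coeff_monomial]
    split_ifs
    · have h : ι ≠ ⟨ι.1, r⟩ := fun h => hr (by
        obtain ⟨i, r'⟩ := ι
        exact (eq_of_heq (Sigma.mk.inj h).2).symm)
      rw [auxVar, partialDeriv_algebraMap, pderiv_X_of_ne h.symm, map_zero]
    · rw [map_zero]
  · exact fun h => absurd (Finset.mem_univ _) h

lemma isCoeffDeriv_genericForm_of_ne (ι : Index d) {i : Fin m} (hi : i ≠ ι.1) :
    IsCoeffDeriv (partialDeriv (k := k) ι) (genericForm k d i) 0 := by
  classical
  intro t
  rw [genericForm, coeff_sum, map_sum, coeff_zero]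
  symm
  refine Finset.sum_eq_zero fun r _ => ?_
  rw [coeff_monomial]
  split_ifs
  · have h : (⟨i, r⟩ : Index d) ≠ ι := fun h => hi (congrArg Sigma.fst h)
    rw [auxVar, partialDeriv_algebraMap, pderiv_X_of_ne h, map_zero]
  · rw [map_zero]

lemma isCoeffDeriv_monomial_mul_prod (ι : Index d) (t : Fin m →₀ ℕ) (e : Fin m → ℕ) :
    IsCoeffDeriv (partialDeriv (k := k) ι) (monomial t 1 * ∏ i, genericForm k d i ^ e i)
      (e ι.1 • (monomial (t + ι.2.1) 1 *
        ∏ i, genericForm k d i ^ (e i - if ι.1 = i then 1 else 0))) := by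
  classical
  have h1 := (isCoeffDeriv_genericForm (k := k) ι).pow (e ι.1)
  have h2 : IsCoeffDeriv (partialDeriv (k := k) ι)
      (∏ i ∈ Finset.univ.erase ι.1, genericForm k d i ^ e i) 0 := by
    refine IsCoeffDeriv.prod_zero _ _ fun i hi => ?_
    have := (isCoeffDeriv_genericForm_of_ne (k := k) ι (Finset.ne_of_mem_erase hi)).pow (e i)
    simpa using this
  have h3 := (IsCoeffDeriv.monomial_one t).mul (h1.mul h2)
  rw [Finset.mul_prod_erase _ (fun i => genericForm k d i ^ e i) (Finset.mem_univ ι.1)] at h3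
  have h4 : ∏ i, genericForm k d i ^ (e i - if ι.1 = i then 1 else 0) =
      genericForm k d ι.1 ^ (e ι.1 - 1) *
        ∏ i ∈ Finset.univ.erase ι.1, genericForm k d i ^ e i := by
    rw [← Finset.mul_prod_erase _ _ (Finset.mem_univ ι.1), if_pos rfl]
    congr 1
    refine Finset.prod_congr rfl fun i hi => ?_
    rw [if_neg (Finset.ne_of_mem_erase hi).symm, Nat.sub_zero]
  convert h3 using 1
  rw [h4, ← one_mul (1 : AuxField k d), ← monomial_mul, one_mul]
  simp only [nsmul_eq_mul]
  ring

variable (p : ℕ) [CharP k p]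

/-- Differentiating `∏ g_i^{n_i}` under a Frobenius functional: every `∂/∂a_{i,r}` lowers the
exponent of `g_i` by one and produces the factor `x^r`. -/
lemma multiDeriv_frobeniusFunctional (V : MvPolynomial (Fin m) (AuxField k d) →ₗ[AuxField k d]
    AuxField k d) (t : Fin m →₀ ℕ) (n : Fin m → ℕ) (J : Multiset (Index d)) :
    multiDeriv J (frobeniusFunctional p V (monomial t 1 * ∏ i, genericForm k d i ^ n i)) =
      (∏ i, (n i).descFactorial (J.countP fun ι => ι.1 = i)) •
        frobeniusFunctional p V (monomial (t + indexExponent J) 1 *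
          ∏ i, genericForm k d i ^ (n i - J.countP fun ι => ι.1 = i)) := by
  classical
  have : CharP (AuxPoly k d) p :=
    charP_of_injective_algebraMap (MvPolynomial.C_injective (Index d) k) p
  have : CharP (AuxField k d) p := IsFractionRing.charP_of_isFractionRing (AuxPoly k d) p
  induction J using Multiset.induction_on with
  | empty => simp [multiDeriv, indexExponent]
  | cons ι J ih =>
    have h1 : ∀ f : AuxField k d,
        multiDeriv (ι ::ₘ J) f = partialDeriv ι (multiDeriv J f) := by
      intro f
      rw [multiDeriv, Multiset.foldr_cons, multiDeriv]
    have h2 : indexExponent (ι ::ₘ J) = indexExponent J + ι.2.1 := by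
      rw [indexExponent, Multiset.map_cons, Multiset.sum_cons, add_comm]; rfl
    have h3 : ∀ i, (ι ::ₘ J).countP (fun κ => κ.1 = i) =
        J.countP (fun κ => κ.1 = i) + if ι.1 = i then 1 else 0 := fun i =>
      Multiset.countP_cons _ _ _
    have h4 : ∏ i, (n i).descFactorial ((ι ::ₘ J).countP fun κ => κ.1 = i) =
        (∏ i, (n i).descFactorial (J.countP fun κ => κ.1 = i)) *
          (n ι.1 - J.countP fun κ => κ.1 = ι.1) := by
      have h5 : ∏ i ∈ Finset.univ.erase ι.1,
          (n i).descFactorial ((ι ::ₘ J).countP fun κ => κ.1 = i) =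
          ∏ i ∈ Finset.univ.erase ι.1, (n i).descFactorial (J.countP fun κ => κ.1 = i) := by
        refine Finset.prod_congr rfl fun i hi => ?_
        rw [h3, if_neg (Finset.ne_of_mem_erase hi).symm, add_zero]
      rw [← Finset.mul_prod_erase _ (fun i => (n i).descFactorial ((ι ::ₘ J).countP
        fun κ => κ.1 = i)) (Finset.mem_univ ι.1), ← Finset.mul_prod_erase _
        (fun i => (n i).descFactorial (J.countP fun κ => κ.1 = i)) (Finset.mem_univ ι.1), h5, h3,
        if_pos rfl, Nat.descFactorial_succ]
      ring
    rw [h1, ih, map_nsmul, derivation_frobeniusFunctional _ _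
      (isCoeffDeriv_monomial_mul_prod ι _ _), map_nsmul, smul_smul, h4, h2, ← add_assoc]
    simp only [h3, Nat.sub_sub]

end Differentiation

/-! ### The differential identity -/

section Identity

open MvPolynomial

variable {k : Type*} [Field k] {m : ℕ} {d : Fin m → ℕ}

lemma frobeniusFunctional_eq_truncate {F : Type*} [Field F] {p : ℕ} (hp : p.Prime)
    (V : MvPolynomial (Fin m) F →ₗ[F] F) (t : Fin m →₀ ℕ) (I : Multiset (Index d)) :
    frobeniusFunctional p V (monomial (t + indexExponent I) 1) =
      V (truncate F m (laurentRoot F p (laurentExponent p t I))) ^ p := by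
  classical
  have hp0 : (p : ℤ) ≠ 0 := by exact_mod_cast hp.ne_zero
  have hdvd : ∀ j, (p : ℤ) ∣ laurentExponent p t I j ↔ (t + indexExponent I) j % p = p - 1 := by
    intro j
    have h1 : laurentExponent p t I j = (((t + indexExponent I) j + 1 : ℕ) : ℤ) - p := by
      rw [laurentExponent, Finsupp.add_apply]; push_cast; ring
    rw [h1, dvd_sub_self_right, Int.natCast_dvd_natCast]
    rw [Nat.dvd_iff_mod_eq_zero, Nat.add_mod]
    have hlt := Nat.mod_lt ((t + indexExponent I) j) hp.pos
    rw [Nat.mod_eq_of_lt hp.one_lt]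
    constructor
    · intro h
      by_contra hne
      rw [Nat.mod_eq_of_lt (by omega)] at h
      omega
    · intro h
      rw [h, Nat.sub_add_cancel hp.pos, Nat.mod_self]
  have hdiv : ∀ j, (t + indexExponent I) j % p = p - 1 →
      laurentExponent p t I j / (p : ℤ) = (((t + indexExponent I) j / p : ℕ) : ℤ) := by
    intro j hj
    have h1 := Nat.div_add_mod ((t + indexExponent I) j) p
    rw [hj] at h1
    have h2 : laurentExponent p t I j = (p : ℤ) * (((t + indexExponent I) j / p : ℕ) : ℤ) := by
      have h3 : (((t + indexExponent I) j : ℕ) : ℤ) = (t j : ℤ) + (indexExponent I j : ℤ) := by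
        rw [Finsupp.add_apply]; push_cast; rfl
      rw [laurentExponent, ← h3]
      conv_lhs => rw [← h1]
      rw [Nat.cast_add, Nat.cast_sub hp.pos]
      push_cast
      ring
    rw [h2, Int.mul_ediv_cancel_left _ hp0]
  rw [frobeniusFunctional_monomial, laurentRoot]
  simp only [hdvd]
  split_ifs with h
  · rw [truncate_laurentMonomial]
    · congr 4
      ext j
      simp only [Finsupp.equivFunOnFinite_symm_apply_apply]
      rw [hdiv j (h j), Int.toNat_natCast]
    · intro j
      rw [hdiv j (h j)]
      exact Int.natCast_nonneg _
  · rw [map_zero, map_zero, zero_pow hp.ne_zero]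

lemma cast_factorial_pred (F : Type*) [Field F] (p : ℕ) [Fact p.Prime] [CharP F p] :
    (((p - 1).factorial : ℕ) : F) = -1 := by
  have h := ZMod.wilsons_lemma p
  have h1 : (((p - 1).factorial + 1 : ℕ) : ZMod p) = 0 := by
    rw [Nat.cast_add, h]; simp
  rw [ZMod.natCast_eq_zero_iff] at h1
  have h2 := (CharP.cast_eq_zero_iff F p _).2 h1
  rw [Nat.cast_add, Nat.cast_one] at h2
  exact eq_neg_of_add_eq_zero_left h2

end Identity

end GenericCI

end

theorem theorem4p3 {k : Type*} [Field k] (p : ℕ) (hp : p.Prime) [CharP k p]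
    {m : ℕ} (d : Fin m → ℕ) (hd : ∀ i, 0 < d i) :
    (∃! vol : GenericCI.gradedPiece (GenericCI.genericForm k d) (GenericCI.topDegree d)
        ≃ₗ[GenericCI.AuxField k d] GenericCI.AuxField k d,
      GenericCI.IsResidueMap (GenericCI.genericForm k d) (GenericCI.topDegree d) vol) ∧
    ∀ vol : GenericCI.gradedPiece (GenericCI.genericForm k d) (GenericCI.topDegree d)
        ≃ₗ[GenericCI.AuxField k d] GenericCI.AuxField k d,
      GenericCI.IsResidueMap (GenericCI.genericForm k d) (GenericCI.topDegree d) vol →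
      ∀ (t : Fin m →₀ ℕ) (ht : t.degree = GenericCI.topDegree d)
        (I : Multiset (GenericCI.Index d)) (hI : GenericCI.HasProperty p I),
        GenericCI.multiDeriv I
            (vol (GenericCI.projDeg (GenericCI.genericForm k d) (GenericCI.topDegree d)
              ⟨MvPolynomial.monomial t 1, GenericCI.monomial_mem _ ht⟩)) =
          (-1) ^ m *
            (vol (GenericCI.projDeg (GenericCI.genericForm k d) (GenericCI.topDegree d)
              ⟨GenericCI.truncate (GenericCI.AuxField k d) m
                  (GenericCI.laurentRoot (GenericCI.AuxField k d) p
                    (GenericCI.laurentExponent p t I)),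
                GenericCI.truncate_laurentRoot_mem _ hp.pos hd ht hI⟩)) ^ p := by
  refine ⟨GenericCI.existsUnique_isResidueMap hd, fun vol hvol t ht I hI => ?_⟩
  have : Fact p.Prime := ⟨hp⟩
  have : CharP (GenericCI.AuxPoly k d) p :=
    charP_of_injective_algebraMap (MvPolynomial.C_injective (GenericCI.Index d) k) p
  have : CharP (GenericCI.AuxField k d) p :=
    IsFractionRing.charP_of_isFractionRing (GenericCI.AuxPoly k d) p
  obtain ⟨N, hNx, hNh, -⟩ := GenericCI.exists_matrix (k := k) hd
  rw [← GenericCI.volFunctional_of_mem, ← GenericCI.volFunctional_of_mem,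
    GenericCI.volFunctional_eq_frobeniusFunctional (p := p)
      (GenericCI.genericForm_isHomogeneous k d) vol hvol hNx hNh _ (GenericCI.monomial_mem _ ht),
    GenericCI.multiDeriv_frobeniusFunctional p _ t (fun _ => p - 1) I]
  have hcount : ∀ i : Fin m, I.countP (fun ι => ι.1 = i) = p - 1 := hI
  simp only [hcount, Nat.sub_self, pow_zero, Finset.prod_const_one, mul_one,
    Nat.descFactorial_self, Finset.prod_const, Finset.card_univ, Fintype.card_fin]
  rw [GenericCI.frobeniusFunctional_eq_truncate hp, nsmul_eq_mul, Nat.cast_pow,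
    GenericCI.cast_factorial_pred]
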